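/- Let $(M,g)$ be a connected smooth Riemannian manifold of dimension $2$ and let $x:M\to\mathbb E^3$ be a smooth isometric immersion into Euclidean $3$-space. Let $\Delta$ be the Laplace operator of $(M,g)$, given in local coordinates by $$\Delta u=-\frac1{\sqrt{\det g}}\sum_{i,j}\partial_i\bigl(\sqrt{\det g}\,g^{ij}\,\partial_j u\bigr),$$ and let $L=\Delta x:M\to\mathbb E^3$ be the Laplace map, where $\Delta$ is applied to each component of $x$. The Laplace transformation $M\to L(M)$ is called homothetic if there is a constant $c>0$ such that $$\langle dL_p(X),dL_p(Y)\rangle=c^2\,g_p(X,Y)\qquad\text{for all }p\in M,\ X,Y\in T_pM .$$ Then the Laplace transformation of $x$ is homothetic if and only if the surface is an open portion of a round sphere, that is, if and only if there are a point $a\in\mathbb E^3$ and a radius $r>0$ such that $x(M)$ is a (relatively) open subset of the sphere $\{y\in\mathbb E^3:\|y-a\|=r\}$. -/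

import Mathlib

open scoped Manifold ContDiff

noncomputable section

/-- The Euclidean space `𝔼^m`. -/
abbrev EuclSpace (m : ℕ) : Type := EuclideanSpace ℝ (Fin m)

/-- A smooth Riemannian metric on the (boundaryless) smooth `n`-manifold `M`. -/
abbrev SmoothMetric (n : ℕ) (M : Type*) [TopologicalSpace M] [ChartedSpace (EuclSpace n) M]
    [IsManifold (𝓡 n) ∞ M] : Type _ :=
  Bundle.ContMDiffRiemannianMetric (𝓡 n) ∞ (EuclSpace n)
    (fun p : M => TangentSpace (𝓡 n) p)

section Laplace

variable {n : ℕ} {M : Type*} [TopologicalSpace M] [ChartedSpace (EuclSpace n) M]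
  [IsManifold (𝓡 n) ∞ M]

/-- The coordinate vector field `∂/∂yᵢ` of the preferred chart `φ` around `p`, at the point
`φ⁻¹ y` of `M`. -/
def coordVector (p : M) (i : Fin n) (y : EuclSpace n) :
    TangentSpace (𝓡 n) ((extChartAt (𝓡 n) p).symm y) :=
  mfderiv 𝓘(ℝ, EuclSpace n) (𝓡 n) (extChartAt (𝓡 n) p).symm y (EuclideanSpace.single i (1 : ℝ))

/-- The matrix `(g_{ij})` of the metric in the coordinates given by the preferred chart
around `p`. -/
def metricMatrix (g : SmoothMetric n M) (p : M) (y : EuclSpace n) :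
    Matrix (Fin n) (Fin n) ℝ :=
  Matrix.of fun i j =>
    g.inner ((extChartAt (𝓡 n) p).symm y) (coordVector p i y) (coordVector p j y)

/-- The partial derivative `∂F/∂yᵢ` of a map on `ℝⁿ`. -/
def partialD {F : Type*} [NormedAddCommGroup F] [NormedSpace ℝ F] (i : Fin n)
    (f : EuclSpace n → F) (y : EuclSpace n) : F :=
  fderiv ℝ f y (EuclideanSpace.single i (1 : ℝ))

/-- The Laplace operator of the Riemannian manifold `(M, g)` (with the geometers' sign, so that it
is `-d²/ds²` on the line), applied to a map `u` with values in a normed space: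
`Δu = - (1/√det g) ∑ᵢ ∂ᵢ (√det g ∑ⱼ gⁱʲ ∂ⱼ u)`,
evaluated at `p` in the preferred chart around `p`. The value does not depend on the chart if
`u` is smooth. -/
def laplaceOp {F : Type*} [NormedAddCommGroup F] [NormedSpace ℝ F]
    (g : SmoothMetric n M) (u : M → F) (p : M) : F :=
  -((Real.sqrt (metricMatrix g p (extChartAt (𝓡 n) p p)).det)⁻¹ •
    ∑ i : Fin n, partialD i
      (fun y => Real.sqrt (metricMatrix g p y).det •
        ∑ j : Fin n, (metricMatrix g p y)⁻¹ i j •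
          partialD j (u ∘ (extChartAt (𝓡 n) p).symm) y)
      (extChartAt (𝓡 n) p p))

/-- The differential `dx` of a map `x : M → 𝔼^m` at `p`, with values in `𝔼^m`. -/
def differential {m : ℕ} (x : M → EuclSpace m) (p : M) :
    TangentSpace (𝓡 n) p →L[ℝ] EuclSpace m :=
  mfderiv (𝓡 n) 𝓘(ℝ, EuclSpace m) x p

/-- `x : (M, g) → 𝔼^m` is a smooth isometric immersion: its differential preserves inner products
(and is therefore injective). -/
structure IsIsometricImmersion {m : ℕ} (g : SmoothMetric n M) (x : M → EuclSpace m) : Prop where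
  smooth : ContMDiff (𝓡 n) 𝓘(ℝ, EuclSpace m) ∞ x
  isometric : ∀ (p : M) (v w : TangentSpace (𝓡 n) p),
    inner ℝ (differential x p v) (differential x p w) = g.inner p v w

/-- The Laplace map `L = Δx` of `x : (M, g) → 𝔼^m`. -/
def laplaceMap {m : ℕ} (g : SmoothMetric n M) (x : M → EuclSpace m) : M → EuclSpace m :=
  laplaceOp g x

/-- The Laplace transformation `M → L(M)` of `x : (M, g) → 𝔼^m` is homothetic: it
multiplies the metric by a positive constant, `⟨dL X, dL Y⟩ = c² ⟨X, Y⟩`. -/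
def HasHomotheticLaplaceTransformation {m : ℕ} (g : SmoothMetric n M) (x : M → EuclSpace m) :
    Prop :=
  ∃ c : ℝ, 0 < c ∧ ∀ (p : M) (v w : TangentSpace (𝓡 n) p),
    inner ℝ (differential (laplaceMap g x) p v) (differential (laplaceMap g x) p w)
      = c ^ 2 * g.inner p v w

end Laplace

/-- `S` is an open portion (a subset open in the subspace topology) of a round
hypersphere of positive radius in `𝔼^m`. -/
def IsOpenPortionOfSphere {m : ℕ} (S : Set (EuclSpace m)) : Prop :=
  ∃ (a : EuclSpace m) (r : ℝ), 0 < r ∧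
    ∃ U : Set (EuclSpace m), IsOpen U ∧ S = Metric.sphere a r ∩ U

end

/-!
Write `f` for the immersion in a chart, `fᵢ` for its partial derivatives and `L` for its Laplace
map. The vector `L` is characterized by two conditions (`IsLaplaceVector`): it is normal to the
surface, and `L + tr_g D²f` is tangent to it. Neither depends on the chart, so although the Laplace
operator is evaluated at each point in the preferred chart of that point, `L` is smooth and can be
computed in any fixed chart (`IsIsometricImmersion.isLaplaceVector`).

On a sphere of radius `r` and centre `a` the two conditions are satisfied by `(2 / r²) (x - a)`, and
hence `L` is homothetic with factor `2 / r²`.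

Conversely let `⟨Lᵢ, Lⱼ⟩ = c² ⟨fᵢ, fⱼ⟩`. The map `L` has no zero: there `L₁, L₂` would both be normal
to the surface, although they are linearly independent. Put `s = |L|²`. Differentiating
`⟨L, fᵢ⟩ = 0` shows that `⟨Lᵢ, fⱼ⟩` is symmetric with trace `s`. If `ds(X) = 0`, then `dL(X)` is
tangent, and linear algebra in an orthogonal frame containing `df(X)` gives `dL(X) = c df(X)`; the
other possible sign is excluded by the trace, as `c > 0` (`laplace_frame`).

It remains to see that `s` is stationary everywhere. Suppose it is not, on an open set. There
`d(L - c f)` vanishes on the kernel of `ds`, so `d(L - c f) = q ds`; taking exterior derivatives,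
`dq = r ds` for some `r`, and `dr` is proportional to `ds` as well (`exists_derivative_along`). Let
`Y` be a vector field spanning the kernel of `ds` and `ξ = df(Y)`. The homothety condition yields
`⟨q, L⟩ = 1/2`, `|q|² = c / (2s²)`, `⟨r, L⟩ = -c / (4s²)`, `⟨r, q⟩ = -|q|² / s`, and
`q, r, L` are orthogonal to `ξ`. So they are linearly dependent. Since `Yq = Yr = 0` and
`YL = c ξ`, pairing the relation with `Yξ` shows that `L` does not occur in it, and then the inner
products above force `s = c / 2`: a contradiction (`HomotheticPatch.partialD_normSq_eq_zero`).

Hence `dL = c df` on the whole surface, so `L = c (x - a)` for a constant vector `a`, by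
connectedness. As `L` is normal, `|x - a|` is constant. Finally the image is open in the sphere,
because the cone over it is open by the inverse function theorem
(`exists_isOpen_sphere_inter_subset_image`).
-/

noncomputable section

local notation "⟪" a "," b "⟫" => inner ℝ a b

/-! ### Calculus of partial derivatives -/

section PartialDerivatives

variable {F : Type*} [NormedAddCommGroup F] [InnerProductSpace ℝ F]
  {n : ℕ} {U : Set (EuclSpace n)} {y : EuclSpace n}

theorem ContDiffOn.diffAt {u : EuclSpace n → F} (hu : ContDiffOn ℝ ∞ u U) (hU : IsOpen U)
    (hy : y ∈ U) : DifferentiableAt ℝ u y :=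
  (hu.contDiffAt (hU.mem_nhds hy)).differentiableAt (by simp)

theorem ContDiffOn.partialD {u : EuclSpace n → F} (hu : ContDiffOn ℝ ∞ u U) (hU : IsOpen U)
    (i : Fin n) : ContDiffOn ℝ ∞ (partialD i u) U :=
  (hu.fderiv_of_isOpen hU (m := ∞) (by simp)).clm_apply contDiffOn_const

theorem partialD_inner {u v : EuclSpace n → F} (hu : DifferentiableAt ℝ u y)
    (hv : DifferentiableAt ℝ v y) (i : Fin n) :
    partialD i (fun z => inner ℝ (u z) (v z)) y
      = inner ℝ (u y) (partialD i v y) + inner ℝ (partialD i u y) (v y) :=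
  fderiv_inner_apply ℝ hu hv _

theorem partialD_smul {a : EuclSpace n → ℝ} {v : EuclSpace n → F} (ha : DifferentiableAt ℝ a y)
    (hv : DifferentiableAt ℝ v y) (i : Fin n) :
    partialD i (fun z => a z • v z) y = a y • partialD i v y + partialD i a y • v y := by
  unfold partialD
  rw [fderiv_fun_smul ha hv]
  simp

theorem partialD_mul {a b : EuclSpace n → ℝ} (ha : DifferentiableAt ℝ a y)
    (hb : DifferentiableAt ℝ b y) (i : Fin n) :
    partialD i (fun z => a z * b z) y = a y * partialD i b y + partialD i a y * b y :=
  partialD_smul ha hb i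

theorem partialD_add {u v : EuclSpace n → F} (hu : DifferentiableAt ℝ u y)
    (hv : DifferentiableAt ℝ v y) (i : Fin n) :
    partialD i (fun z => u z + v z) y = partialD i u y + partialD i v y := by
  unfold partialD
  rw [fderiv_fun_add hu hv]
  simp

theorem partialD_sub {u v : EuclSpace n → F} (hu : DifferentiableAt ℝ u y)
    (hv : DifferentiableAt ℝ v y) (i : Fin n) :
    partialD i (fun z => u z - v z) y = partialD i u y - partialD i v y := by
  unfold partialD
  rw [fderiv_fun_sub hu hv]
  simp

theorem partialD_const (a : F) (i : Fin n) : partialD i (fun _ : EuclSpace n => a) y = 0 := by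
  simp [partialD]

theorem partialD_const_smul {v : EuclSpace n → F} (a : ℝ)
    (hv : DifferentiableAt ℝ v y) (i : Fin n) :
    partialD i (fun z => a • v z) y = a • partialD i v y := by
  rw [partialD_smul (differentiableAt_const a) hv, partialD_const, zero_smul, add_zero]

theorem partialD_congr {u v : EuclSpace n → F} (hU : IsOpen U) (hy : y ∈ U)
    (h : ∀ z ∈ U, u z = v z) (i : Fin n) : partialD i u y = partialD i v y := by
  unfold partialD
  rw [Filter.EventuallyEq.fderiv_eq (Filter.eventually_of_mem (hU.mem_nhds hy) h)]

theorem partialD_comm {u : EuclSpace n → F} (hu : ContDiffOn ℝ ∞ u U) (hU : IsOpen U)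
    (hy : y ∈ U) (i j : Fin n) :
    partialD i (partialD j u) y = partialD j (partialD i u) y := by
  have h1 : DifferentiableAt ℝ (fderiv ℝ u) y :=
    ((hu.fderiv_of_isOpen hU (m := ∞) (by simp)).contDiffAt (hU.mem_nhds hy)).differentiableAt
      (by simp)
  have h2 : IsSymmSndFDerivAt ℝ u y :=
    (hu.contDiffAt (hU.mem_nhds hy)).isSymmSndFDerivAt (by
      rw [minSmoothness_of_isRCLikeNormedField]; exact ENat.LEInfty.out)
  have h3 : ∀ k l : Fin n, _root_.partialD k (_root_.partialD l u) y
      = fderiv ℝ (fderiv ℝ u) y (EuclideanSpace.single k 1) (EuclideanSpace.single l 1) := by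
    intro k l
    unfold _root_.partialD
    rw [fderiv_clm_apply h1 (differentiableAt_const _)]
    simp
  rw [h3, h3]
  exact h2 _ _

/-- Every derivative on `ℝ²` is a combination of the two partial derivatives. -/
theorem fderiv_eq_partialD {u : EuclSpace 2 → F} (y v : EuclSpace 2) :
    fderiv ℝ u y v = v 0 • partialD 0 u y + v 1 • partialD 1 u y := by
  have : v = v 0 • EuclideanSpace.single 0 (1 : ℝ) + v 1 • EuclideanSpace.single 1 (1 : ℝ) := by
    ext i; fin_cases i <;> simp
  conv_lhs => rw [this]
  simp [partialD]

end PartialDerivatives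

/-! ### Linear algebra in Euclidean three-space -/

section LinearAlgebra

theorem exists_nontrivial_relation_of_orthogonal {ξ : EuclSpace 3} (hξ : ξ ≠ 0)
    {u v w : EuclSpace 3} (hu : ⟪u, ξ⟫ = 0) (hv : ⟪v, ξ⟫ = 0) (hw : ⟪w, ξ⟫ = 0) :
    ∃ a b d : ℝ, a • u + b • v + d • w = 0 ∧ ¬(a = 0 ∧ b = 0 ∧ d = 0) := by
  by_contra! H
  have hli : LinearIndependent ℝ ![ξ, u, v, w] := by
    rw [Fintype.linearIndependent_iff]
    intro g hg
    simp only [Fin.sum_univ_four, Matrix.cons_val_zero, Matrix.cons_val_one, Matrix.cons_val] at hg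
    have h0 : g 0 = 0 := by
      have := congrArg (fun z => ⟪z, ξ⟫) hg
      simp only [inner_add_left, inner_smul_left, hu, hv, hw, inner_zero_left] at this
      simpa [hξ] using this
    rw [h0, zero_smul, zero_add] at hg
    obtain ⟨h1, h2, h3⟩ := H _ _ _ hg
    intro i
    fin_cases i <;> assumption
  have := hli.fintype_card_le_finrank
  simp at this

theorem eq_zero_of_orthogonal_triple {ξ ζ ℓ v : EuclSpace 3} (hξ : ξ ≠ 0) (hζ : ζ ≠ 0)
    (hℓ : ℓ ≠ 0) (h1 : ⟪ζ, ξ⟫ = 0) (h2 : ⟪ℓ, ξ⟫ = 0) (h3 : ⟪ℓ, ζ⟫ = 0)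
    (v1 : ⟪v, ξ⟫ = 0) (v2 : ⟪v, ζ⟫ = 0) (v3 : ⟪v, ℓ⟫ = 0) : v = 0 := by
  obtain ⟨a, b, d, h, hn⟩ := exists_nontrivial_relation_of_orthogonal hξ h1 h2 v1
  have e1 := congrArg (fun z => ⟪z, ζ⟫) h
  have e2 := congrArg (fun z => ⟪z, ℓ⟫) h
  simp only [inner_add_left, inner_smul_left, h3, v2, v3, real_inner_comm ℓ ζ,
    inner_zero_left] at e1 e2
  have ha : a = 0 := by simpa [hζ] using e1
  have hb : b = 0 := by simpa [hℓ] using e2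
  subst ha hb
  have hd : d ≠ 0 := by tauto
  simpa [hd] using h

/-- The expansion of a vector in an orthogonal basis of `𝔼³`. -/
theorem eq_sum_of_orthogonal_triple {ξ ζ ℓ : EuclSpace 3} (hξ : ξ ≠ 0) (hζ : ζ ≠ 0)
    (hℓ : ℓ ≠ 0) (h1 : ⟪ζ, ξ⟫ = 0) (h2 : ⟪ℓ, ξ⟫ = 0) (h3 : ⟪ℓ, ζ⟫ = 0) (v : EuclSpace 3) :
    v = (⟪v, ξ⟫ / ⟪ξ, ξ⟫) • ξ + (⟪v, ζ⟫ / ⟪ζ, ζ⟫) • ζ + (⟪v, ℓ⟫ / ⟪ℓ, ℓ⟫) • ℓ := by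
  have n1 : ⟪ξ, ξ⟫ ≠ 0 := by simpa using hξ
  have n2 : ⟪ζ, ζ⟫ ≠ 0 := by simpa using hζ
  have n3 : ⟪ℓ, ℓ⟫ ≠ 0 := by simpa using hℓ
  rw [← sub_eq_zero]
  apply eq_zero_of_orthogonal_triple hξ hζ hℓ h1 h2 h3
  all_goals
    simp only [inner_sub_left, inner_add_left, real_inner_smul_left, h1, h2, h3,
      real_inner_comm ζ ξ, real_inner_comm ℓ ξ, real_inner_comm ℓ ζ]
    field_simp
    ring

/-- Here `ξ, ζ` is an orthogonal frame of the tangent plane, `ℓ` is the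
(nonzero) Laplace vector, `A, B` are its derivatives in the directions of `ξ, ζ`. If the
derivative of `|ℓ|²` vanishes in the direction of `ξ`, then that direction is principal,
and `A = c ξ`. The second identity computes the length of `q` in `B = c ζ + t q`, where
`t = 2⟨B, ℓ⟩` is the derivative of `|ℓ|²` in the direction of `ζ`. -/
theorem laplace_frame {ξ ζ ℓ A B : EuclSpace 3} {c : ℝ} (hc : 0 < c) (hξ : ξ ≠ 0) (hζ : ζ ≠ 0)
    (hℓ : ℓ ≠ 0) (h1 : ⟪ζ, ξ⟫ = 0) (h2 : ⟪ℓ, ξ⟫ = 0) (h3 : ⟪ℓ, ζ⟫ = 0)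
    (hAB : ⟪A, B⟫ = 0) (hAA : ⟪A, A⟫ = c ^ 2 * ⟪ξ, ξ⟫) (hBB : ⟪B, B⟫ = c ^ 2 * ⟪ζ, ζ⟫)
    (hsym : ⟪A, ζ⟫ = ⟪B, ξ⟫) (htr : ⟪A, ξ⟫ / ⟪ξ, ξ⟫ + ⟪B, ζ⟫ / ⟪ζ, ζ⟫ = ⟪ℓ, ℓ⟫)
    (hA : ⟪A, ℓ⟫ = 0) :
    A = c • ξ ∧
      2 * ⟪ℓ, ℓ⟫ ^ 2 * ⟪B - c • ζ, B - c • ζ⟫ = c * (2 * ⟪B, ℓ⟫) ^ 2 := by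
  have n1 : 0 < ⟪ξ, ξ⟫ := real_inner_self_pos.2 hξ
  have n2 : 0 < ⟪ζ, ζ⟫ := real_inner_self_pos.2 hζ
  have n3 : 0 < ⟪ℓ, ℓ⟫ := real_inner_self_pos.2 hℓ
  have eA := eq_sum_of_orthogonal_triple hξ hζ hℓ h1 h2 h3 A
  have eB := eq_sum_of_orthogonal_triple hξ hζ hℓ h1 h2 h3 B
  rw [hA, zero_div, zero_smul, add_zero] at eA
  rw [← hsym] at eB
  set α := ⟪A, ξ⟫ / ⟪ξ, ξ⟫
  set δ := ⟪B, ζ⟫ / ⟪ζ, ζ⟫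
  set β := ⟪A, ζ⟫ with hβ
  set t := ⟪B, ℓ⟫
  set X := ⟪ξ, ξ⟫ with hX
  set Z := ⟪ζ, ζ⟫ with hZ
  set s := ⟪ℓ, ℓ⟫ with hs
  have hβ0 : β = 0 := by
    have : ⟪A, B⟫ = β * s := by
      rw [eA, eB]
      simp only [inner_add_left, real_inner_smul_left, inner_add_right, real_inner_smul_right,
        h1, h2, h3, real_inner_comm ζ ξ, real_inner_comm ℓ ξ, real_inner_comm ℓ ζ, ← hX, ← hZ]
      rw [← htr]
      field_simp
      ring
    rw [hAB] at this
    rcases mul_eq_zero.1 this.symm with h | h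
    · exact h
    · exact absurd h n3.ne'
  rw [hβ0, zero_div, zero_smul, add_zero] at eA
  rw [hβ0, zero_div, zero_smul, zero_add] at eB
  have hα : α ^ 2 = c ^ 2 := by
    rw [eA, real_inner_smul_left, real_inner_smul_right] at hAA
    have : α * (α * X) = c ^ 2 * X := hAA
    apply mul_right_cancel₀ n1.ne'
    linarith
  have hB2 : δ ^ 2 * Z + t ^ 2 / s = c ^ 2 * Z := by
    rw [← hBB, eB]
    simp only [inner_add_left, real_inner_smul_left, inner_add_right, real_inner_smul_right,
        h3, real_inner_comm ℓ ζ, ← hZ, ← hs]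
    field_simp
    ring
  have hαc : α = c := by
    rcases sq_eq_sq_iff_eq_or_eq_neg.1 hα with h | h
    · exact h
    -- `α = -c` would give `δ = s + c`, so that `B` would be too long
    · exfalso
      have : 0 ≤ t ^ 2 / s := by positivity
      have hδ : δ = s + c := by linarith
      rw [hδ] at hB2
      nlinarith [mul_pos n3 n2, mul_pos (mul_pos n3 n2) hc, mul_pos (mul_pos n3 n2) n3]
  rw [hαc] at eA htr
  refine ⟨eA, ?_⟩
  have hδ : δ = s - c := by linarith
  have e : B - c • ζ = (s - 2 * c) • ζ + (t / s) • ℓ := by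
    rw [eB, hδ]
    module
  rw [e]
  simp only [inner_add_left, real_inner_smul_left, inner_add_right, real_inner_smul_right,
        h3, real_inner_comm ℓ ζ, ← hZ, ← hs]
  rw [hδ] at hB2
  have ht : t ^ 2 = s * (c ^ 2 - (s - c) ^ 2) * Z := by
    field_simp at hB2
    linarith
  field_simp
  linear_combination (s - 2 * c) * ht

/-- `laplace_frame` in terms of an arbitrary basis `u₁, u₂` of the tangent plane, the direction
`ξ = X₁ u₁ + X₂ u₂` and the direction `ζ` orthogonal to it. -/
theorem laplace_frame_of_basis {u₁ u₂ ℓ ℓ₁ ℓ₂ : EuclSpace 3} {c D m₁ m₂ X₁ X₂ : ℝ} (hc : 0 < c)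
    (hℓ : ℓ ≠ 0) (hn₁ : ⟪ℓ, u₁⟫ = 0) (hn₂ : ⟪ℓ, u₂⟫ = 0)
    (hD : D = ⟪u₁, u₁⟫ * ⟪u₂, u₂⟫ - ⟪u₁, u₂⟫ ^ 2) (hD0 : D ≠ 0)
    (h₁₁ : ⟪ℓ₁, ℓ₁⟫ = c ^ 2 * ⟪u₁, u₁⟫) (h₁₂ : ⟪ℓ₁, ℓ₂⟫ = c ^ 2 * ⟪u₁, u₂⟫)
    (h₂₂ : ⟪ℓ₂, ℓ₂⟫ = c ^ 2 * ⟪u₂, u₂⟫) (hsym : ⟪ℓ₁, u₂⟫ = ⟪ℓ₂, u₁⟫)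
    (htr : D * ⟪ℓ, ℓ⟫ = ⟪u₂, u₂⟫ * ⟪ℓ₁, u₁⟫ - 2 * ⟪u₁, u₂⟫ * ⟪ℓ₁, u₂⟫ + ⟪u₁, u₁⟫ * ⟪ℓ₂, u₂⟫)
    (hm₁ : m₁ = ⟪u₁, u₁⟫ * X₁ + ⟪u₁, u₂⟫ * X₂) (hm₂ : m₂ = ⟪u₁, u₂⟫ * X₁ + ⟪u₂, u₂⟫ * X₂)
    (hX : X₁ ≠ 0 ∨ X₂ ≠ 0) (hXs : X₁ * ⟪ℓ₁, ℓ⟫ + X₂ * ⟪ℓ₂, ℓ⟫ = 0) :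
    X₁ • ℓ₁ + X₂ • ℓ₂ = c • (X₁ • u₁ + X₂ • u₂) ∧
      2 * ⟪ℓ, ℓ⟫ ^ 2 * ⟪(-m₂) • (ℓ₁ - c • u₁) + m₁ • (ℓ₂ - c • u₂),
        (-m₂) • (ℓ₁ - c • u₁) + m₁ • (ℓ₂ - c • u₂)⟫
        = c * (2 * (-m₂ * ⟪ℓ₁, ℓ⟫ + m₁ * ⟪ℓ₂, ℓ⟫)) ^ 2 := by
  set ξ := X₁ • u₁ + X₂ • u₂ with hξ
  set ζ := (-m₂) • u₁ + m₁ • u₂ with hζ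
  have c₁ := real_inner_comm u₁ u₂
  have hξξ : ⟪ξ, ξ⟫ = X₁ * m₁ + X₂ * m₂ := by
    simp only [hξ, inner_add_left, inner_add_right, real_inner_smul_left, real_inner_smul_right,
      c₁, hm₁, hm₂]
    ring
  have hζζ : ⟪ζ, ζ⟫ = D * ⟪ξ, ξ⟫ := by
    rw [hξξ]
    simp only [hζ, inner_add_left, inner_add_right, real_inner_smul_left, real_inner_smul_right,
      c₁, hm₁, hm₂, hD]
    ring
  have hξ0 : ξ ≠ 0 := by
    intro h
    have e₁ : m₁ = 0 := by
      have : ⟪u₁, ξ⟫ = 0 := by rw [h, inner_zero_right]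
      rw [hm₁, ← this, hξ, inner_add_right, real_inner_smul_right, real_inner_smul_right]
      ring
    have e₂ : m₂ = 0 := by
      have : ⟪u₂, ξ⟫ = 0 := by rw [h, inner_zero_right]
      rw [hm₂, ← this, hξ, inner_add_right, real_inner_smul_right, real_inner_smul_right, c₁]
      ring
    have k₁ : D * X₁ = 0 := by
      rw [hD]; linear_combination ⟪u₂, u₂⟫ * (e₁ - hm₁) - ⟪u₁, u₂⟫ * (e₂ - hm₂)
    have k₂ : D * X₂ = 0 := by
      rw [hD]; linear_combination ⟪u₁, u₁⟫ * (e₂ - hm₂) - ⟪u₁, u₂⟫ * (e₁ - hm₁)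
    rcases hX with h | h
    · exact h ((mul_eq_zero.1 k₁).resolve_left hD0)
    · exact h ((mul_eq_zero.1 k₂).resolve_left hD0)
  have hξp : ⟪ξ, ξ⟫ ≠ 0 := by simpa using hξ0
  have hζ0 : ζ ≠ 0 := by
    intro h
    rw [h, inner_zero_left] at hζζ
    exact (mul_ne_zero hD0 hξp) hζζ.symm
  have key := laplace_frame (ξ := ξ) (ζ := ζ) (ℓ := ℓ) (A := X₁ • ℓ₁ + X₂ • ℓ₂)
    (B := (-m₂) • ℓ₁ + m₁ • ℓ₂) hc hξ0 hζ0 hℓ ?_ ?_ ?_ ?_ ?_ ?_ ?_ ?_ ?_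
  · refine ⟨key.1, ?_⟩
    have := key.2
    rw [inner_add_left, real_inner_smul_left, real_inner_smul_left] at this
    rw [← this]
    have e : (-m₂) • ℓ₁ + m₁ • ℓ₂ - c • ζ
        = (-m₂) • (ℓ₁ - c • u₁) + m₁ • (ℓ₂ - c • u₂) := by
      rw [hζ]; module
    rw [e]
  · simp only [hξ, hζ, inner_add_left, inner_add_right, real_inner_smul_left,
      real_inner_smul_right, c₁, hm₁, hm₂]
    ring
  · simp [hξ, inner_add_right, real_inner_smul_right, hn₁, hn₂]
  · simp [hζ, inner_add_right, real_inner_smul_right, hn₁, hn₂]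
  · simp only [inner_add_left, inner_add_right, real_inner_smul_left,
      real_inner_smul_right, real_inner_comm ℓ₁ ℓ₂, h₁₁, h₁₂, h₂₂, hm₁, hm₂]
    ring
  · simp only [hξ, inner_add_left, inner_add_right, real_inner_smul_left,
      real_inner_smul_right, real_inner_comm ℓ₁ ℓ₂, h₁₁, h₁₂, h₂₂, c₁]
    ring
  · simp only [hζ, inner_add_left, inner_add_right, real_inner_smul_left,
      real_inner_smul_right, real_inner_comm ℓ₁ ℓ₂, h₁₁, h₁₂, h₂₂, c₁]
    ring
  · simp only [hξ, hζ, inner_add_left, inner_add_right, real_inner_smul_left,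
      real_inner_smul_right, hsym]
    ring
  · rw [hζζ]
    have e : ⟪X₁ • ℓ₁ + X₂ • ℓ₂, ξ⟫ * D + ⟪(-m₂) • ℓ₁ + m₁ • ℓ₂, ζ⟫ = ⟪ξ, ξ⟫ * (D * ⟪ℓ, ℓ⟫) := by
      rw [htr, hξξ]
      simp only [hξ, hζ, inner_add_left, inner_add_right, real_inner_smul_left,
        real_inner_smul_right, ← hsym, hm₁, hm₂, hD]
      ring
    field_simp
    linear_combination e
  · rw [inner_add_left, real_inner_smul_left, real_inner_smul_left, hXs]

end LinearAlgebra

/-! ### Laplace vectors and homothetic surface patches -/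

section LocalSurface

/-- The Gram determinant `EG - F²` of a map `f` defined on (a part of) `ℝ²`. -/
def gramDet {F : Type*} [NormedAddCommGroup F] [InnerProductSpace ℝ F] (f : EuclSpace 2 → F)
    (y : EuclSpace 2) : ℝ :=
  ⟪partialD 0 f y, partialD 0 f y⟫ * ⟪partialD 1 f y, partialD 1 f y⟫
    - ⟪partialD 0 f y, partialD 1 f y⟫ ^ 2

/-- The vector `G f₁₁ - 2F f₁₂ + E f₂₂`: the trace of the second derivative of `f` with respect to
the induced metric, multiplied by `EG - F²`. -/
def secondDerivTrace {F : Type*} [NormedAddCommGroup F] [InnerProductSpace ℝ F]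
    (f : EuclSpace 2 → F) (y : EuclSpace 2) : F :=
  ⟪partialD 1 f y, partialD 1 f y⟫ • partialD 0 (partialD 0 f) y
    - (2 * ⟪partialD 0 f y, partialD 1 f y⟫) • partialD 0 (partialD 1 f) y
    + ⟪partialD 0 f y, partialD 0 f y⟫ • partialD 1 (partialD 1 f) y

/-- `ℓ` is the Laplacian, with respect to the induced metric, of the immersion `f` at `y`: it is
normal to the surface, and opposite to the normal part of the trace of the second derivative. These
conditions determine `ℓ` and do not depend on the parametrization. -/
structure IsLaplaceVector {F : Type*} [NormedAddCommGroup F] [InnerProductSpace ℝ F]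
    (f : EuclSpace 2 → F) (y : EuclSpace 2) (ℓ : F) : Prop where
  normal : ∀ i, ⟪ℓ, partialD i f y⟫ = 0
  trace : ∃ α β : ℝ, gramDet f y • ℓ + secondDerivTrace f y
    = α • partialD 0 f y + β • partialD 1 f y

variable {U : Set (EuclSpace 2)} {f L : EuclSpace 2 → EuclSpace 3} {c : ℝ}

/-- The data of a surface patch whose Laplace map multiplies the induced metric by `c²`. -/
structure HomotheticPatch (U : Set (EuclSpace 2)) (f L : EuclSpace 2 → EuclSpace 3) (c : ℝ) :
    Prop where
  pos : 0 < c
  isOpen : IsOpen U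
  smooth : ContDiffOn ℝ ∞ f U
  smooth' : ContDiffOn ℝ ∞ L U
  gramDet_ne_zero : ∀ y ∈ U, gramDet f y ≠ 0
  laplace : ∀ y ∈ U, IsLaplaceVector f y (L y)
  homothetic : ∀ y ∈ U, ∀ i j,
    ⟪partialD i L y, partialD j L y⟫ = c ^ 2 * ⟪partialD i f y, partialD j f y⟫

namespace HomotheticPatch

theorem inner_partialD (P : HomotheticPatch U f L c) {y : EuclSpace 2} (hy : y ∈ U) (i j : Fin 2) :
    ⟪partialD j L y, partialD i f y⟫ = -⟪L y, partialD j (partialD i f) y⟫ := by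
  have h := partialD_inner (P.smooth'.diffAt P.isOpen hy)
    ((P.smooth.partialD P.isOpen i).diffAt P.isOpen hy) j
  rw [partialD_congr (v := fun _ => (0 : ℝ)) P.isOpen hy (fun z hz => (P.laplace z hz).normal i) j,
    partialD_const] at h
  linarith

theorem inner_partialD_symm (P : HomotheticPatch U f L c) {y : EuclSpace 2} (hy : y ∈ U) :
    ⟪partialD 0 L y, partialD 1 f y⟫ = ⟪partialD 1 L y, partialD 0 f y⟫ := by
  rw [P.inner_partialD hy, P.inner_partialD hy, partialD_comm P.smooth P.isOpen hy]

/-- The symmetric form `⟨Lᵢ, fⱼ⟩`, which is minus the second fundamental form in the direction of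
`L`, has trace `|L|²` with respect to the induced metric. -/
theorem trace_eq (P : HomotheticPatch U f L c) {y : EuclSpace 2} (hy : y ∈ U) :
    gramDet f y * ⟪L y, L y⟫
      = ⟪partialD 1 f y, partialD 1 f y⟫ * ⟪partialD 0 L y, partialD 0 f y⟫
        - 2 * ⟪partialD 0 f y, partialD 1 f y⟫ * ⟪partialD 0 L y, partialD 1 f y⟫
        + ⟪partialD 0 f y, partialD 0 f y⟫ * ⟪partialD 1 L y, partialD 1 f y⟫ := by
  obtain ⟨hn, α, β, h⟩ := P.laplace y hy
  have h' := congrArg (fun v => ⟪L y, v⟫) h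
  simp only [secondDerivTrace, inner_add_right, inner_sub_right, real_inner_smul_right, hn] at h'
  rw [P.inner_partialD hy, P.inner_partialD hy, P.inner_partialD hy]
  linarith

/-- At a zero of `L`, both derivatives of `L` would be normal to the surface, but they span a plane,
and there is only one normal direction. -/
theorem ne_zero (P : HomotheticPatch U f L c) {y : EuclSpace 2} (hy : y ∈ U) : L y ≠ 0 := by
  intro h0
  have hz : ∀ i j, ⟪partialD j L y, partialD i f y⟫ = 0 := fun i j => by
    rw [P.inner_partialD hy, h0, inner_zero_left, neg_zero]
  have hD := P.gramDet_ne_zero y hy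
  have hh := P.homothetic y hy
  have hc := P.pos
  unfold gramDet at hD
  set u₁ := partialD 0 f y
  set u₂ := partialD 1 f y
  set ℓ₁ := partialD 0 L y
  set ℓ₂ := partialD 1 L y
  have c₁ := real_inner_comm u₁ u₂
  have hu₁ : u₁ ≠ 0 := by
    intro h
    rw [h] at hD
    simp at hD
  have hw : ⟪⟪u₁, u₁⟫ • u₂ - ⟪u₁, u₂⟫ • u₁, u₁⟫ = 0 := by
    rw [inner_sub_left, real_inner_smul_left, real_inner_smul_left, c₁]
    ring
  obtain ⟨a, b, d, h, hn⟩ := exists_nontrivial_relation_of_orthogonal hu₁ (hz 0 0) (hz 0 1) hw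
  have e₁ := congrArg (fun v => ⟪v, u₂⟫) h
  simp only [inner_add_left, inner_sub_left, real_inner_smul_left, inner_zero_left] at e₁
  rw [hz 1 0, hz 1 1] at e₁
  have hd : d = 0 := by
    have : d * (⟪u₁, u₁⟫ * ⟪u₂, u₂⟫ - ⟪u₁, u₂⟫ ^ 2) = 0 := by linarith
    exact (mul_eq_zero.1 this).resolve_right hD
  rw [hd, zero_smul, add_zero] at h
  have e₂ := congrArg (fun v => ⟪ℓ₁, v⟫) h
  have e₃ := congrArg (fun v => ⟪ℓ₂, v⟫) h
  simp only [inner_add_right, real_inner_smul_right, inner_zero_right] at e₂ e₃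
  rw [hh 0 0, hh 0 1] at e₂
  rw [hh 1 0, hh 1 1] at e₃
  change a * (c ^ 2 * ⟪u₁, u₁⟫) + b * (c ^ 2 * ⟪u₁, u₂⟫) = 0 at e₂
  change a * (c ^ 2 * ⟪u₂, u₁⟫) + b * (c ^ 2 * ⟪u₂, u₂⟫) = 0 at e₃
  rw [c₁] at e₃
  have hcD : c ^ 2 * (⟪u₁, u₁⟫ * ⟪u₂, u₂⟫ - ⟪u₁, u₂⟫ ^ 2) ≠ 0 := mul_ne_zero (by positivity) hD
  have ha : a = 0 := by
    refine (mul_eq_zero.1 ?_).resolve_right hcD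
    linear_combination ⟪u₂, u₂⟫ * e₂ - ⟪u₁, u₂⟫ * e₃
  have hb : b = 0 := by
    refine (mul_eq_zero.1 ?_).resolve_right hcD
    linear_combination ⟪u₁, u₁⟫ * e₃ - ⟪u₁, u₂⟫ * e₂
  exact hn ⟨ha, hb, hd⟩

theorem partialD_normSq (P : HomotheticPatch U f L c) {y : EuclSpace 2} (hy : y ∈ U) (i : Fin 2) :
    partialD i (fun z => ⟪L z, L z⟫) y = 2 * ⟪partialD i L y, L y⟫ := by
  have hL := P.smooth'.diffAt P.isOpen hy
  rw [partialD_inner hL hL, real_inner_comm]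
  ring

/-- In a direction `X` in which `|L|²` is stationary, the derivative of `L` is `c` times that of
`f`. The direction `Z` is the one with `df(Z)` orthogonal to `df(X)`, and the second part determines
the length of the component of `d(L - c f)(Z)`. -/
theorem derivative_eq_of_stationary (P : HomotheticPatch U f L c) {y : EuclSpace 2} (hy : y ∈ U)
    {X₁ X₂ : ℝ} (hX : X₁ ≠ 0 ∨ X₂ ≠ 0)
    (hXs : X₁ * partialD 0 (fun z => ⟪L z, L z⟫) y
      + X₂ * partialD 1 (fun z => ⟪L z, L z⟫) y = 0) :
    X₁ • partialD 0 L y + X₂ • partialD 1 L y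
        = c • (X₁ • partialD 0 f y + X₂ • partialD 1 f y) ∧
      ∃ Z₁ Z₂ : ℝ, (Z₁ * X₂ - Z₂ * X₁
          = -⟪X₁ • partialD 0 f y + X₂ • partialD 1 f y,
              X₁ • partialD 0 f y + X₂ • partialD 1 f y⟫) ∧
        2 * ⟪L y, L y⟫ ^ 2 *
          ⟪Z₁ • (partialD 0 L y - c • partialD 0 f y) + Z₂ • (partialD 1 L y - c • partialD 1 f y),
            Z₁ • (partialD 0 L y - c • partialD 0 f y) + Z₂ • (partialD 1 L y - c • partialD 1 f y)⟫
        = c * (Z₁ * partialD 0 (fun z => ⟪L z, L z⟫) y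
            + Z₂ * partialD 1 (fun z => ⟪L z, L z⟫) y) ^ 2 := by
  rw [P.partialD_normSq hy, P.partialD_normSq hy] at *
  have hXs' : X₁ * ⟪partialD 0 L y, L y⟫ + X₂ * ⟪partialD 1 L y, L y⟫ = 0 := by linarith
  have h := laplace_frame_of_basis (X₁ := X₁) (X₂ := X₂) P.pos (P.ne_zero hy)
    ((P.laplace y hy).normal 0) ((P.laplace y hy).normal 1) rfl (P.gramDet_ne_zero y hy)
    (P.homothetic y hy 0 0) (P.homothetic y hy 0 1) (P.homothetic y hy 1 1)
    (P.inner_partialD_symm hy) (P.trace_eq hy) rfl rfl hX hXs'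
  refine ⟨h.1, _, _, ?_, h.2.trans ?_⟩
  · simp only [inner_add_left, inner_add_right, real_inner_smul_left, real_inner_smul_right,
      real_inner_comm (partialD 0 f y) (partialD 1 f y)]
    ring
  · ring

end HomotheticPatch

end LocalSurface

/-! ### The squared length of the Laplace map is stationary -/

section FunctionsOfOneParameter

/-- If `du` is proportional to `dφ ≠ 0` at every point, then `du = q dφ` for a smooth `q`, and `dq`
is again proportional to `dφ`: both `u` and `q` are locally functions of `φ`. -/
theorem exists_derivative_along {F : Type*} [NormedAddCommGroup F] [InnerProductSpace ℝ F]
    {V : Set (EuclSpace 2)} (hV : IsOpen V) {φ : EuclSpace 2 → ℝ} (hφ : ContDiffOn ℝ ∞ φ V)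
    (h0 : ∀ y ∈ V, partialD 0 φ y ≠ 0 ∨ partialD 1 φ y ≠ 0) {u : EuclSpace 2 → F}
    (hu : ContDiffOn ℝ ∞ u V)
    (h : ∀ y ∈ V, partialD 1 φ y • partialD 0 u y = partialD 0 φ y • partialD 1 u y) :
    ∃ q : EuclSpace 2 → F, ContDiffOn ℝ ∞ q V ∧
      (∀ y ∈ V, ∀ i, partialD i u y = partialD i φ y • q y) ∧
      ∀ y ∈ V, partialD 1 φ y • partialD 0 q y = partialD 0 φ y • partialD 1 q y := by
  have hw : ∀ y ∈ V, partialD 0 φ y ^ 2 + partialD 1 φ y ^ 2 ≠ 0 := by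
    intro y hy
    rcases h0 y hy with k | k <;> positivity
  set q : EuclSpace 2 → F := fun y => (partialD 0 φ y ^ 2 + partialD 1 φ y ^ 2)⁻¹ •
    (partialD 0 φ y • partialD 0 u y + partialD 1 φ y • partialD 1 u y) with hq
  have φ0 := hφ.partialD hV 0
  have φ1 := hφ.partialD hV 1
  have hqs : ContDiffOn ℝ ∞ q V :=
    (((φ0.pow 2).add (φ1.pow 2)).inv hw).smul
      ((φ0.smul (hu.partialD hV 0)).add (φ1.smul (hu.partialD hV 1)))
  have hd : ∀ y ∈ V, ∀ i, partialD i u y = partialD i φ y • q y := by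
    intro y hy i
    have hwy := hw y hy
    have hy' := h y hy
    have e : (partialD 0 φ y ^ 2 + partialD 1 φ y ^ 2) • partialD i u y
        = partialD i φ y •
          (partialD 0 φ y • partialD 0 u y + partialD 1 φ y • partialD 1 u y) := by
      fin_cases i
      · simp only [Fin.zero_eta]
        linear_combination (norm := module) partialD 1 φ y • hy'
      · simp only [Fin.mk_one]
        linear_combination (norm := module) (-partialD 0 φ y) • hy'
    simp only [hq]
    rw [smul_comm, ← e, inv_smul_smul₀ hwy]
  refine ⟨q, hqs, hd, fun y hy => ?_⟩
  have hc := partialD_comm hu hV hy 0 1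
  rw [partialD_congr hV hy (fun z hz => hd z hz 1) 0,
    partialD_congr hV hy (fun z hz => hd z hz 0) 1,
    partialD_smul (φ1.diffAt hV hy) (hqs.diffAt hV hy),
    partialD_smul (φ0.diffAt hV hy) (hqs.diffAt hV hy),
    partialD_comm hφ hV hy 0 1] at hc
  exact add_right_cancel hc

namespace HomotheticPatch

variable {U : Set (EuclSpace 2)} {f L : EuclSpace 2 → EuclSpace 3} {c : ℝ}

theorem smooth_normSq (P : HomotheticPatch U f L c) :
    ContDiffOn ℝ ∞ (fun z => ⟪L z, L z⟫) U :=
  P.smooth'.inner ℝ P.smooth'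

/-- The function `s = |L|²` is stationary: on the open set where it is not, it would have to be equal
to the constant `c / 2`. -/
theorem partialD_normSq_eq_zero (P : HomotheticPatch U f L c) {y : EuclSpace 2} (hy : y ∈ U) :
    partialD 0 (fun z => ⟪L z, L z⟫) y = 0 ∧ partialD 1 (fun z => ⟪L z, L z⟫) y = 0 := by
  have hc := P.pos
  set s : EuclSpace 2 → ℝ := fun z => ⟪L z, L z⟫ with hs
  have sU : ContDiffOn ℝ ∞ s U := P.smooth_normSq
  set V : Set (EuclSpace 2) := {z ∈ U | partialD 0 s z ≠ 0 ∨ partialD 1 s z ≠ 0} with hVdef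
  have hVU : V ⊆ U := fun z hz => hz.1
  have hV : IsOpen V := by
    have e : V = (U ∩ (partialD 0 s) ⁻¹' {0}ᶜ) ∪ (U ∩ (partialD 1 s) ⁻¹' {0}ᶜ) := by
      ext z
      simp only [hVdef, Set.mem_ofPred_eq, Set.mem_union, Set.mem_inter_iff, Set.mem_preimage,
        Set.mem_compl_iff, Set.mem_singleton_iff]
      tauto
    rw [e]
    exact ((sU.partialD P.isOpen 0).continuousOn.isOpen_inter_preimage P.isOpen
        isOpen_compl_singleton).union
      ((sU.partialD P.isOpen 1).continuousOn.isOpen_inter_preimage P.isOpen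
        isOpen_compl_singleton)
  have sV := sU.mono hVU
  have fV := P.smooth.mono hVU
  have LV := P.smooth'.mono hVU
  have hne : ∀ z ∈ V, partialD 0 s z ≠ 0 ∨ partialD 1 s z ≠ 0 := fun z hz => hz.2
  have hpos : ∀ z ∈ V, 0 < s z := fun z hz => real_inner_self_pos.2 (P.ne_zero (hVU hz))
  have L_normal : ∀ z ∈ V, ∀ i, ⟪L z, partialD i f z⟫ = 0 :=
    fun z hz i => (P.laplace z (hVU hz)).normal i
  have sd : ∀ z ∈ V, ∀ i, partialD i s z = 2 * ⟪partialD i L z, L z⟫ :=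
    fun z hz i => P.partialD_normSq (hVU hz) i
  -- on `V` a number vanishes as soon as its products with both `∂ᵢ s` do
  have cancel : ∀ z ∈ V, ∀ a : ℝ, (∀ i, partialD i s z * a = 0) → a = 0 := by
    intro z hz a ha
    rcases hne z hz with k | k
    · exact (mul_eq_zero.1 (ha 0)).resolve_left k
    · exact (mul_eq_zero.1 (ha 1)).resolve_left k
  -- `(∂₁ s, -∂₀ s)` spans the kernel of `ds`
  have frame : ∀ z ∈ V, _ := fun z hz => P.derivative_eq_of_stationary (hVU hz)
    (X₁ := partialD 1 s z) (X₂ := -partialD 0 s z) (by simpa [or_comm] using hne z hz) (by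
      change _ * partialD 0 s z + _ * partialD 1 s z = 0; ring)
  -- `L - c f` is a function of `s`, with derivative `q`, and so is `q`, with derivative `r`
  set u : EuclSpace 2 → EuclSpace 3 := fun z => L z - c • f z with hu
  have uV : ContDiffOn ℝ ∞ u V := LV.sub (fV.const_smul c)
  have ud : ∀ z ∈ V, ∀ i, partialD i u z = partialD i L z - c • partialD i f z := by
    intro z hz i
    rw [hu, partialD_sub (LV.diffAt hV hz) ((fV.diffAt hV hz).fun_const_smul c),
      partialD_const_smul c (fV.diffAt hV hz)]
  obtain ⟨q, qV, hq, hq'⟩ := exists_derivative_along hV sV hne uV (by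
    intro z hz
    rw [ud z hz, ud z hz]
    linear_combination (norm := module) (frame z hz).1)
  obtain ⟨r, rV, hr, hr'⟩ := exists_derivative_along hV sV hne qV hq'
  have Ld : ∀ z ∈ V, ∀ i, partialD i L z = c • partialD i f z + partialD i s z • q z := by
    intro z hz i
    rw [← hq z hz i, ud z hz]
    abel
  set ξ : EuclSpace 2 → EuclSpace 3 :=
    fun z => partialD 1 s z • partialD 0 f z - partialD 0 s z • partialD 1 f z with hξ
  have ξV : ContDiffOn ℝ ∞ ξ V :=
    ((sV.partialD hV 1).smul (fV.partialD hV 0)).sub ((sV.partialD hV 0).smul (fV.partialD hV 1))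
  have ξ_ne : ∀ z ∈ V, ξ z ≠ 0 := by
    intro z hz h
    have e₀ : ⟪ξ z, partialD 0 f z⟫ = 0 := by rw [h, inner_zero_left]
    have e₁ : ⟪ξ z, partialD 1 f z⟫ = 0 := by rw [h, inner_zero_left]
    simp only [hξ, inner_sub_left, real_inner_smul_left,
      real_inner_comm (partialD 0 f z) (partialD 1 f z)] at e₀ e₁
    refine P.gramDet_ne_zero z (hVU hz) (cancel z hz _ fun i => ?_)
    unfold gramDet
    fin_cases i
    · simp only [Fin.zero_eta]
      linear_combination ⟪partialD 0 f z, partialD 1 f z⟫ * e₀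
        - ⟪partialD 0 f z, partialD 0 f z⟫ * e₁
    · simp only [Fin.mk_one]
      linear_combination ⟪partialD 1 f z, partialD 1 f z⟫ * e₀
        - ⟪partialD 0 f z, partialD 1 f z⟫ * e₁
  have YL : ∀ z ∈ V, partialD 1 s z • partialD 0 L z - partialD 0 s z • partialD 1 L z
      = c • ξ z := by
    intro z hz
    rw [Ld z hz, Ld z hz, hξ]
    module
  have q_L : ∀ z ∈ V, ⟪q z, L z⟫ = 1 / 2 := by
    intro z hz
    rw [← sub_eq_zero]
    refine cancel z hz _ fun i => ?_
    have h := sd z hz i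
    rw [Ld z hz i, inner_add_left, real_inner_smul_left, real_inner_smul_left, real_inner_comm,
      L_normal z hz] at h
    linarith
  -- the direction `Z` orthogonal to the kernel of `ds` determines the length of `q`
  have q_q : ∀ z ∈ V, s z * s z * ⟪q z, q z⟫ = c / 2 := by
    intro z hz
    obtain ⟨-, Z₁, Z₂, ht, h⟩ := frame z hz
    rw [← ud z hz, ← ud z hz, hq z hz, hq z hz, smul_smul, smul_smul, ← add_smul,
      real_inner_smul_left, real_inner_smul_right] at h
    have ht0 : Z₁ * partialD 0 s z + Z₂ * partialD 1 s z ≠ 0 := by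
      intro h0
      refine ξ_ne z hz (inner_self_eq_zero (𝕜 := ℝ).1 ?_)
      have e : partialD 1 s z • partialD 0 f z + -partialD 0 s z • partialD 1 f z = ξ z := by
        rw [hξ]; module
      rw [e] at ht
      linarith
    change 2 * s z ^ 2 * (_ * (_ * _)) = c * (Z₁ * partialD 0 s z + Z₂ * partialD 1 s z) ^ 2 at h
    apply mul_left_cancel₀ (pow_ne_zero 2 ht0)
    linear_combination h / 2
  have q_f : ∀ z ∈ V, ∀ i, 4 * (s z * s z) * ⟪q z, partialD i f z⟫ = -partialD i s z := by
    intro z hz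
    have h : ∀ i j, partialD j s z * (2 * c * ⟪q z, partialD i f z⟫ + partialD i s z * ⟪q z, q z⟫)
        + partialD i s z * (2 * c * ⟪q z, partialD j f z⟫ + partialD j s z * ⟪q z, q z⟫) = 0 := by
      intro i j
      have h := P.homothetic z (hVU hz) i j
      rw [Ld z hz, Ld z hz] at h
      simp only [inner_add_left, inner_add_right, real_inner_smul_left, real_inner_smul_right,
        real_inner_comm (q z) (partialD i f z)] at h
      linear_combination 2 * h
    have h' : ∀ i, 2 * c * ⟪q z, partialD i f z⟫ + partialD i s z * ⟪q z, q z⟫ = 0 := by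
      obtain ⟨k, hk⟩ : ∃ k, partialD k s z ≠ 0 := (hne z hz).elim (fun h => ⟨0, h⟩) fun h => ⟨1, h⟩
      have hkk : 2 * c * ⟪q z, partialD k f z⟫ + partialD k s z * ⟪q z, q z⟫ = 0 :=
        (mul_eq_zero.1 (by linarith [h k k])).resolve_left hk
      intro i
      have := h i k
      rw [hkk, mul_zero, add_zero] at this
      exact (mul_eq_zero.1 this).resolve_left hk
    intro i
    apply mul_left_cancel₀ hc.ne'
    linear_combination 2 * s z ^ 2 * h' i - 2 * partialD i s z * q_q z hz
  have r_L : ∀ z ∈ V, s z * s z * ⟪r z, L z⟫ = -c / 4 := by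
    intro z hz
    rw [← sub_eq_zero]
    refine cancel z hz _ fun i => ?_
    have h := partialD_inner (qV.diffAt hV hz) (LV.diffAt hV hz) i
    rw [partialD_congr hV hz q_L, partialD_const, Ld z hz, hr z hz, inner_add_right,
      real_inner_smul_right, real_inner_smul_right, real_inner_smul_left] at h
    linear_combination -(s z) ^ 2 * h - c / 4 * q_f z hz i - partialD i s z * q_q z hz
  have r_q : ∀ z ∈ V, s z * ⟪r z, q z⟫ + ⟪q z, q z⟫ = 0 := by
    intro z hz
    refine cancel z hz _ fun i => ?_
    have ds := sV.diffAt hV hz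
    have dq := qV.diffAt hV hz
    have h := partialD_mul (ds.fun_mul ds) (dq.inner ℝ dq) i
    rw [partialD_congr hV hz q_q, partialD_const, partialD_inner dq dq] at h
    rw [partialD_mul ds ds, hr z hz, real_inner_smul_left, real_inner_smul_right,
      real_inner_comm (r z)] at h
    apply mul_left_cancel₀ (hpos z hz).ne'
    linear_combination -h / 2
  have r_ξ : ∀ z ∈ V, ⟪r z, ξ z⟫ = 0 := by
    intro z hz
    have ds := sV.diffAt hV hz
    have dr := rV.diffAt hV hz
    have dL := LV.diffAt hV hz
    have h : ∀ i, 0 = s z * s z * (⟪r z, partialD i L z⟫ + ⟪partialD i r z, L z⟫)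
        + (s z * partialD i s z + partialD i s z * s z) * ⟪r z, L z⟫ := by
      intro i
      have h := partialD_mul (ds.fun_mul ds) (dr.inner ℝ dL) i
      rw [partialD_congr hV hz r_L, partialD_const, partialD_inner dr dL,
        partialD_mul ds ds] at h
      exact h
    have e1 := congrArg (fun v => ⟪r z, v⟫) (YL z hz)
    have e2 := congrArg (fun v => ⟪v, L z⟫) (hr' z hz)
    simp only [inner_sub_right, real_inner_smul_left, real_inner_smul_right] at e1 e2
    apply mul_left_cancel₀ (mul_ne_zero hc.ne' (pow_ne_zero 2 (hpos z hz).ne'))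
    linear_combination -(s z) ^ 2 * e1 - partialD 1 s z * h 0 + partialD 0 s z * h 1
      - (s z) ^ 2 * e2
  have q_ξ : ∀ z ∈ V, ⟪q z, ξ z⟫ = 0 := by
    intro z hz
    have e0 := q_f z hz 0
    have e1 := q_f z hz 1
    simp only [hξ, inner_sub_right, real_inner_smul_right]
    apply mul_left_cancel₀ (pow_ne_zero 2 (hpos z hz).ne')
    linear_combination partialD 1 s z / 4 * e0 - partialD 0 s z / 4 * e1
  have L_ξ : ∀ z ∈ V, ⟪L z, ξ z⟫ = 0 := by
    intro z hz
    simp [hξ, inner_sub_right, real_inner_smul_right, L_normal z hz]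
  -- the derivative of `⟪v, ξ⟫ = 0` along the kernel of `ds`
  have Yv : ∀ v : EuclSpace 2 → EuclSpace 3, ContDiffOn ℝ ∞ v V → (∀ z ∈ V, ⟪v z, ξ z⟫ = 0) →
      ∀ z ∈ V, ⟪v z, partialD 1 s z • partialD 0 ξ z - partialD 0 s z • partialD 1 ξ z⟫
        = -⟪partialD 1 s z • partialD 0 v z - partialD 0 s z • partialD 1 v z, ξ z⟫ := by
    intro v hv h z hz
    have h' : ∀ i, 0 = ⟪v z, partialD i ξ z⟫ + ⟪partialD i v z, ξ z⟫ := by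
      intro i
      rw [← partialD_inner (hv.diffAt hV hz) (ξV.diffAt hV hz), partialD_congr hV hz h,
        partialD_const]
    simp only [inner_sub_left, inner_sub_right, real_inner_smul_left, real_inner_smul_right]
    linear_combination partialD 0 s z * h' 1 - partialD 1 s z * h' 0
  have sc : ∀ z ∈ V, s z = c / 2 := by
    intro z hz
    have rY := Yv r rV r_ξ z hz
    have qY := Yv q qV q_ξ z hz
    have LY := Yv L LV L_ξ z hz
    rw [sub_eq_zero.2 (hr' z hz), inner_zero_left, neg_zero] at rY
    rw [sub_eq_zero.2 (hq' z hz), inner_zero_left, neg_zero] at qY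
    rw [YL z hz, real_inner_smul_left] at LY
    -- `r, q, L` lie in the plane orthogonal to `ξ`
    obtain ⟨a, b, d, h, hn⟩ :=
      exists_nontrivial_relation_of_orthogonal (ξ_ne z hz) (r_ξ z hz) (q_ξ z hz) (L_ξ z hz)
    have e := congrArg (fun v => ⟪v, partialD 1 s z • partialD 0 ξ z
      - partialD 0 s z • partialD 1 ξ z⟫) h
    simp only [inner_add_left, real_inner_smul_left, rY, qY, LY, inner_zero_left] at e
    have hξp : 0 < ⟪ξ z, ξ z⟫ := real_inner_self_pos.2 (ξ_ne z hz)
    have hd : d = 0 := by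
      refine (mul_eq_zero.1 ?_).resolve_right (mul_pos hc hξp).ne'
      linarith
    rw [hd, zero_smul, add_zero] at h
    have eL := congrArg (fun v => ⟪v, L z⟫) h
    have eq := congrArg (fun v => ⟪v, q z⟫) h
    simp only [inner_add_left, real_inner_smul_left, inner_zero_left, q_L z hz] at eL eq
    have hs0 := hpos z hz
    have hb : a = b * s z := by
      have hqq : 0 < ⟪q z, q z⟫ := by
        have := q_q z hz
        by_contra hneg
        push Not at hneg
        nlinarith [mul_pos hs0 hs0]
      apply mul_right_cancel₀ hqq.ne'
      linear_combination a * r_q z hz - s z * eq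
    have hb0 : b ≠ 0 := fun h0 => hn ⟨by rw [hb, h0, zero_mul], h0, hd⟩
    have : b * s z * (s z - c / 2) = 0 := by
      rw [hb] at eL
      linear_combination 2 * s z * s z * eL - 2 * b * s z * r_L z hz
    linarith [(mul_eq_zero.1 this).resolve_left (mul_ne_zero hb0 hs0.ne')]
  by_contra hcon
  have hyV : y ∈ V := ⟨hy, by tauto⟩
  have hz : ∀ i, partialD i s y = 0 := fun i => by
    rw [partialD_congr hV hyV sc, partialD_const]
  exact hcon ⟨hz 0, hz 1⟩

/-- The derivative of the Laplace map of a homothetic patch is `c` times that of the immersion. -/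
theorem partialD_eq (P : HomotheticPatch U f L c) {y : EuclSpace 2} (hy : y ∈ U) (i : Fin 2) :
    partialD i L y = c • partialD i f y := by
  obtain ⟨h0, h1⟩ := P.partialD_normSq_eq_zero hy
  fin_cases i
  · simpa using (P.derivative_eq_of_stationary hy (X₁ := 1) (X₂ := 0) (by simp)
      (by rw [h0, h1]; simp)).1
  · simpa using (P.derivative_eq_of_stationary hy (X₁ := 0) (X₂ := 1) (by simp)
      (by rw [h0, h1]; simp)).1

end HomotheticPatch

end FunctionsOfOneParameter

/-! ### The Laplace vector: explicit formula and change of parameters -/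

section LaplaceVector

variable {F : Type*} [NormedAddCommGroup F] [InnerProductSpace ℝ F]

theorem ContDiffOn.gramDet {U : Set (EuclSpace 2)} {f : EuclSpace 2 → F}
    (hf : ContDiffOn ℝ ∞ f U) (hU : IsOpen U) : ContDiffOn ℝ ∞ (gramDet f) U :=
  (((hf.partialD hU 0).inner ℝ (hf.partialD hU 0)).mul
    ((hf.partialD hU 1).inner ℝ (hf.partialD hU 1))).sub
    (((hf.partialD hU 0).inner ℝ (hf.partialD hU 1)).pow 2)

/-- An explicit formula for the vector characterized by `IsLaplaceVector`: the trace of the second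
derivative minus its tangential part, up to the factor `-(EG - F²)⁻¹`. -/
def laplaceFormula (f : EuclSpace 2 → F) (y : EuclSpace 2) : F :=
  -((gramDet f y)⁻¹ • (secondDerivTrace f y - (gramDet f y)⁻¹ •
    ((⟪partialD 1 f y, partialD 1 f y⟫ * ⟪secondDerivTrace f y, partialD 0 f y⟫
        - ⟪partialD 0 f y, partialD 1 f y⟫ * ⟪secondDerivTrace f y, partialD 1 f y⟫)
        • partialD 0 f y
      + (⟪partialD 0 f y, partialD 0 f y⟫ * ⟪secondDerivTrace f y, partialD 1 f y⟫
        - ⟪partialD 0 f y, partialD 1 f y⟫ * ⟪secondDerivTrace f y, partialD 0 f y⟫)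
        • partialD 1 f y)))

theorem IsLaplaceVector.eq_laplaceFormula {f : EuclSpace 2 → F} {y : EuclSpace 2} {ℓ : F}
    (h : IsLaplaceVector f y ℓ) (hD : _root_.gramDet f y ≠ 0) : ℓ = laplaceFormula f y := by
  obtain ⟨hn, α, β, ht⟩ := h
  have e₀ := congrArg (fun v => ⟪v, partialD 0 f y⟫) ht
  have e₁ := congrArg (fun v => ⟪v, partialD 1 f y⟫) ht
  simp only [inner_add_left, real_inner_smul_left, hn, mul_zero, zero_add,
    real_inner_comm (partialD 0 f y) (partialD 1 f y)] at e₀ e₁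
  unfold laplaceFormula
  rw [e₀, e₁]
  have k₀ : ⟪partialD 1 f y, partialD 1 f y⟫ * (α * ⟪partialD 0 f y, partialD 0 f y⟫
      + β * ⟪partialD 0 f y, partialD 1 f y⟫) - ⟪partialD 0 f y, partialD 1 f y⟫ *
        (α * ⟪partialD 0 f y, partialD 1 f y⟫ + β * ⟪partialD 1 f y, partialD 1 f y⟫)
      = gramDet f y * α := by unfold gramDet; ring
  have k₁ : ⟪partialD 0 f y, partialD 0 f y⟫ * (α * ⟪partialD 0 f y, partialD 1 f y⟫
      + β * ⟪partialD 1 f y, partialD 1 f y⟫) - ⟪partialD 0 f y, partialD 1 f y⟫ *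
        (α * ⟪partialD 0 f y, partialD 0 f y⟫ + β * ⟪partialD 0 f y, partialD 1 f y⟫)
      = gramDet f y * β := by unfold gramDet; ring
  rw [k₀, k₁, mul_smul, mul_smul, ← smul_add, inv_smul_smul₀ hD, ← ht, sub_add_cancel_right,
    smul_neg, neg_neg, inv_smul_smul₀ hD]

theorem contDiffOn_laplaceFormula {U : Set (EuclSpace 2)} (hU : IsOpen U) {f : EuclSpace 2 → F}
    (hf : ContDiffOn ℝ ∞ f U) (hD : ∀ y ∈ U, gramDet f y ≠ 0) :
    ContDiffOn ℝ ∞ (laplaceFormula f) U := by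
  have f0 := hf.partialD hU 0
  have f1 := hf.partialD hU 1
  have hE := f0.inner ℝ f0
  have hF := f0.inner ℝ f1
  have hG := f1.inner ℝ f1
  have hV : ContDiffOn ℝ ∞ (secondDerivTrace f) U :=
    ((hG.smul (f0.partialD hU 0)).sub ((contDiffOn_const.mul hF).smul (f1.partialD hU 0))).add
      (hE.smul (f1.partialD hU 1))
  have hD' := (hf.gramDet hU).inv hD
  have v0 := hV.inner ℝ f0
  have v1 := hV.inner ℝ f1
  exact (hD'.smul (hV.sub (hD'.smul ((((hG.mul v0).sub (hF.mul v1)).smul f0).add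
    (((hE.mul v1).sub (hF.mul v0)).smul f1))))).neg

theorem partialD_comp {E' : Type*} [NormedAddCommGroup E'] [InnerProductSpace ℝ E']
    {f : EuclSpace 2 → E'} {τ : EuclSpace 2 → EuclSpace 2} {y : EuclSpace 2}
    (hf : DifferentiableAt ℝ f (τ y)) (hτ : DifferentiableAt ℝ τ y) (i : Fin 2) :
    partialD i (fun z => f (τ z)) y
      = partialD i τ y 0 • partialD 0 f (τ y) + partialD i τ y 1 • partialD 1 f (τ y) := by
  rw [← fderiv_eq_partialD]
  unfold partialD
  rw [fderiv_fun_comp y hf hτ]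
  rfl

/-- The Laplace vector does not depend on the parametrization. -/
theorem IsLaplaceVector.of_comp {U W : Set (EuclSpace 2)} (hU : IsOpen U) (hW : IsOpen W)
    {f : EuclSpace 2 → F} (hf : ContDiffOn ℝ ∞ f U) {τ : EuclSpace 2 → EuclSpace 2}
    (hτ : ContDiffOn ℝ ∞ τ W) (hmaps : Set.MapsTo τ W U) {y : EuclSpace 2} (hy : y ∈ W) {ℓ : F}
    (hD : _root_.gramDet (fun z => f (τ z)) y ≠ 0)
    (h : IsLaplaceVector (fun z => f (τ z)) y ℓ) : IsLaplaceVector f (τ y) ℓ := by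
  have d1 : ∀ z ∈ W, ∀ i, partialD i (fun z => f (τ z)) z
      = partialD i τ z 0 • partialD 0 f (τ z) + partialD i τ z 1 • partialD 1 f (τ z) :=
    fun z hz i => partialD_comp (hf.diffAt hU (hmaps hz)) (hτ.diffAt hW hz) i
  have dc : ∀ z ∈ W, ∀ i k, DifferentiableAt ℝ (fun z => partialD i τ z k) z := by
    intro z hz i k
    have := (hτ.partialD hW i).diffAt hW hz
    fun_prop
  have d2 : ∀ i j, partialD i (partialD j (fun z => f (τ z))) y
      = partialD j τ y 0 • (partialD i τ y 0 • partialD 0 (partialD 0 f) (τ y)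
          + partialD i τ y 1 • partialD 0 (partialD 1 f) (τ y))
        + partialD i (fun z => partialD j τ z 0) y • partialD 0 f (τ y)
        + (partialD j τ y 1 • (partialD i τ y 0 • partialD 0 (partialD 1 f) (τ y)
          + partialD i τ y 1 • partialD 1 (partialD 1 f) (τ y))
        + partialD i (fun z => partialD j τ z 1) y • partialD 1 f (τ y)) := by
    intro i j
    have hτy := hτ.diffAt hW hy
    have g0 := (hf.partialD hU 0).diffAt hU (hmaps hy)
    have g1 := (hf.partialD hU 1).diffAt hU (hmaps hy)
    have k0 : DifferentiableAt ℝ (fun z => partialD 0 f (τ z)) y := DifferentiableAt.comp y g0 hτy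
    have k1 : DifferentiableAt ℝ (fun z => partialD 1 f (τ z)) y := DifferentiableAt.comp y g1 hτy
    rw [partialD_congr hW hy (fun z hz => d1 z hz j),
      partialD_add ((dc y hy j 0).fun_smul k0) ((dc y hy j 1).fun_smul k1),
      partialD_smul (dc y hy j 0) k0, partialD_smul (dc y hy j 1) k1,
      partialD_comp g0 hτy, partialD_comp g1 hτy, partialD_comm hf hU (hmaps hy) 1 0]
  obtain ⟨hn, α, β, ht⟩ := h
  have hn0 := hn 0
  have hn1 := hn 1
  unfold secondDerivTrace at ht
  rw [d2, d2, d2, d1 y hy, d1 y hy] at ht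
  rw [d1 y hy] at hn0 hn1
  unfold _root_.gramDet at hD ht
  rw [d1 y hy, d1 y hy] at hD
  rw [d1 y hy, d1 y hy] at ht
  set f₀ := partialD 0 f (τ y) with hf₀
  set f₁ := partialD 1 f (τ y) with hf₁
  set a₀ := partialD 0 τ y 0
  set b₀ := partialD 0 τ y 1
  set a₁ := partialD 1 τ y 0
  set b₁ := partialD 1 τ y 1
  have hc := real_inner_comm f₀ f₁
  have hE : ⟪a₀ • f₀ + b₀ • f₁, a₀ • f₀ + b₀ • f₁⟫
      = a₀ ^ 2 * ⟪f₀, f₀⟫ + 2 * a₀ * b₀ * ⟪f₀, f₁⟫ + b₀ ^ 2 * ⟪f₁, f₁⟫ := by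
    simp only [inner_add_left, inner_add_right, real_inner_smul_left, real_inner_smul_right, hc]
    ring
  have hF : ⟪a₀ • f₀ + b₀ • f₁, a₁ • f₀ + b₁ • f₁⟫
      = a₀ * a₁ * ⟪f₀, f₀⟫ + (a₀ * b₁ + a₁ * b₀) * ⟪f₀, f₁⟫ + b₀ * b₁ * ⟪f₁, f₁⟫ := by
    simp only [inner_add_left, inner_add_right, real_inner_smul_left, real_inner_smul_right, hc]
    ring
  have hG : ⟪a₁ • f₀ + b₁ • f₁, a₁ • f₀ + b₁ • f₁⟫
      = a₁ ^ 2 * ⟪f₀, f₀⟫ + 2 * a₁ * b₁ * ⟪f₀, f₁⟫ + b₁ ^ 2 * ⟪f₁, f₁⟫ := by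
    simp only [inner_add_left, inner_add_right, real_inner_smul_left, real_inner_smul_right, hc]
    ring
  rw [hE, hF, hG] at hD ht
  simp only [inner_add_right, real_inner_smul_right] at hn0 hn1
  have hdet : a₀ * b₁ - a₁ * b₀ ≠ 0 := by
    intro h0
    apply hD
    linear_combination
      (a₀ * b₁ - a₁ * b₀) * (⟪f₀, f₀⟫ * ⟪f₁, f₁⟫ - ⟪f₀, f₁⟫ ^ 2) * h0
  refine ⟨fun i => ?_, ?_⟩
  · fin_cases i
    · apply mul_left_cancel₀ hdet
      change _ * ⟪ℓ, f₀⟫ = _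
      linear_combination b₁ * hn0 - b₀ * hn1
    · apply mul_left_cancel₀ hdet
      change _ * ⟪ℓ, f₁⟫ = _
      linear_combination a₀ * hn1 - a₁ * hn0
  · suffices h : ∃ α' β' : ℝ, (a₀ * b₁ - a₁ * b₀) ^ 2 •
        (_root_.gramDet f (τ y) • ℓ + secondDerivTrace f (τ y)) = α' • f₀ + β' • f₁ by
      obtain ⟨α', β', h⟩ := h
      refine ⟨((a₀ * b₁ - a₁ * b₀) ^ 2)⁻¹ * α', ((a₀ * b₁ - a₁ * b₀) ^ 2)⁻¹ * β', ?_⟩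
      rw [mul_smul, mul_smul, ← smul_add, ← hf₀, ← hf₁, ← h, inv_smul_smul₀ (pow_ne_zero 2 hdet)]
    unfold secondDerivTrace _root_.gramDet
    rw [← hf₀, ← hf₁]
    set p := a₀ ^ 2 * ⟪f₀, f₀⟫ + 2 * a₀ * b₀ * ⟪f₀, f₁⟫ + b₀ ^ 2 * ⟪f₁, f₁⟫ with hp
    set q := a₀ * a₁ * ⟪f₀, f₀⟫ + (a₀ * b₁ + a₁ * b₀) * ⟪f₀, f₁⟫ + b₀ * b₁ * ⟪f₁, f₁⟫ with hq
    set r := a₁ ^ 2 * ⟪f₀, f₀⟫ + 2 * a₁ * b₁ * ⟪f₀, f₁⟫ + b₁ ^ 2 * ⟪f₁, f₁⟫ with hr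
    refine ⟨α * a₀ + β * a₁ - (r * partialD 0 (fun z => partialD 0 τ z 0) y
        - 2 * q * partialD 0 (fun z => partialD 1 τ z 0) y
        + p * partialD 1 (fun z => partialD 1 τ z 0) y),
      α * b₀ + β * b₁ - (r * partialD 0 (fun z => partialD 0 τ z 1) y
        - 2 * q * partialD 0 (fun z => partialD 1 τ z 1) y
        + p * partialD 1 (fun z => partialD 1 τ z 1) y), ?_⟩
    rw [hp, hq, hr] at *
    linear_combination (norm := module) ht

end LaplaceVector

/-! ### The coordinate expression of the Laplace operator -/

section Divergence

variable {F : Type*} [NormedAddCommGroup F] [InnerProductSpace ℝ F]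

/-- The coordinate expression of the Laplace operator, applied to an immersion `f` and the metric
induced by it, yields the Laplace vector of `f`. -/
theorem isLaplaceVector_of_divergence {U : Set (EuclSpace 2)} (hU : IsOpen U)
    {f : EuclSpace 2 → F} (hf : ContDiffOn ℝ ∞ f U) (hD : ∀ y ∈ U, 0 < gramDet f y)
    {g : EuclSpace 2 → Matrix (Fin 2) (Fin 2) ℝ}
    (hg : ∀ z ∈ U, ∀ i j, g z i j = ⟪partialD i f z, partialD j f z⟫)
    {y : EuclSpace 2} (hy : y ∈ U) :
    IsLaplaceVector f y (-((Real.sqrt (g y).det)⁻¹ • ∑ i : Fin 2, partialD i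
      (fun z => Real.sqrt (g z).det • ∑ j : Fin 2, (g z)⁻¹ i j • partialD j f z) y)) := by
  have hdet : ∀ z ∈ U, (g z).det = gramDet f z := by
    intro z hz
    rw [Matrix.det_fin_two, hg z hz, hg z hz, hg z hz, hg z hz, gramDet,
      real_inner_comm (partialD 0 f z) (partialD 1 f z)]
    ring
  set ρ : EuclSpace 2 → ℝ := fun z => (Real.sqrt (gramDet f z))⁻¹ with hρ
  set Ef : EuclSpace 2 → ℝ := fun z => ⟪partialD 0 f z, partialD 0 f z⟫ with hEf
  set Ff : EuclSpace 2 → ℝ := fun z => ⟪partialD 0 f z, partialD 1 f z⟫ with hFf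
  set Gf : EuclSpace 2 → ℝ := fun z => ⟪partialD 1 f z, partialD 1 f z⟫ with hGf
  -- `√det g • g⁻¹` is `ρ` times the adjugate matrix of `g`
  have hsq : ∀ z ∈ U, gramDet f z * (ρ z * ρ z) = 1 := by
    intro z hz
    have h := Real.mul_self_sqrt (hD z hz).le
    have h' := Real.sqrt_pos.2 (hD z hz)
    simp only [hρ]
    field_simp
    linarith
  have hsqrt : ∀ z ∈ U, Real.sqrt (g z).det * (gramDet f z)⁻¹ = ρ z := by
    intro z hz
    have h := Real.mul_self_sqrt (hD z hz).le
    have h' := Real.sqrt_pos.2 (hD z hz)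
    have h'' := hD z hz
    rw [hdet z hz]
    simp only [hρ]
    field_simp
    linarith
  have hinv : ∀ z ∈ U, (g z)⁻¹ = (gramDet f z)⁻¹ • !![g z 1 1, -g z 0 1; -g z 1 0, g z 0 0] := by
    intro z hz
    rw [Matrix.inv_def, Matrix.adjugate_fin_two, hdet z hz, Ring.inverse_eq_inv']
  have e0 : ∀ z ∈ U, Real.sqrt (g z).det • ∑ j : Fin 2, (g z)⁻¹ 0 j • partialD j f z
      = ρ z • (Gf z • partialD 0 f z - Ff z • partialD 1 f z) := by
    intro z hz
    rw [← hsqrt z hz, hinv z hz, Fin.sum_univ_two]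
    simp only [Matrix.smul_apply, Matrix.of_apply, Matrix.cons_val', Matrix.cons_val_zero,
      Matrix.cons_val_one, Matrix.cons_val_fin_one, hg z hz, smul_eq_mul, hGf, hFf]
    module
  have e1 : ∀ z ∈ U, Real.sqrt (g z).det • ∑ j : Fin 2, (g z)⁻¹ 1 j • partialD j f z
      = ρ z • (Ef z • partialD 1 f z - Ff z • partialD 0 f z) := by
    intro z hz
    rw [← hsqrt z hz, hinv z hz, Fin.sum_univ_two]
    simp only [Matrix.smul_apply, Matrix.of_apply, Matrix.cons_val', Matrix.cons_val_zero,
      Matrix.cons_val_one, Matrix.cons_val_fin_one, hg z hz, smul_eq_mul, hEf, hFf,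
      real_inner_comm (partialD 0 f z) (partialD 1 f z)]
    module
  have f0 := (hf.partialD hU 0).diffAt hU hy
  have f1 := (hf.partialD hU 1).diffAt hU hy
  have dE : DifferentiableAt ℝ Ef y := f0.inner ℝ f0
  have dF : DifferentiableAt ℝ Ff y := f0.inner ℝ f1
  have dG : DifferentiableAt ℝ Gf y := f1.inner ℝ f1
  have dD : DifferentiableAt ℝ (gramDet f) y := (hf.gramDet hU).diffAt hU hy
  have dρ : DifferentiableAt ℝ ρ y :=
    (dD.sqrt (hD y hy).ne').fun_inv (Real.sqrt_pos.2 (hD y hy)).ne'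
  have hc := partialD_comm hf hU hy 1 0
  have Ei : ∀ i, partialD i Ef y = 2 * ⟪partialD i (partialD 0 f) y, partialD 0 f y⟫ := by
    intro i
    rw [hEf, partialD_inner f0 f0, real_inner_comm]; ring
  have Gi : ∀ i, partialD i Gf y = 2 * ⟪partialD i (partialD 1 f) y, partialD 1 f y⟫ := by
    intro i
    rw [hGf, partialD_inner f1 f1, real_inner_comm]; ring
  have Fi : ∀ i, partialD i Ff y = ⟪partialD i (partialD 1 f) y, partialD 0 f y⟫
      + ⟪partialD i (partialD 0 f) y, partialD 1 f y⟫ := by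
    intro i
    rw [hFf, partialD_inner f0 f1, real_inner_comm]
  have Di : ∀ i, partialD i (gramDet f) y = Ef y * partialD i Gf y + partialD i Ef y * Gf y
      - 2 * Ff y * partialD i Ff y := by
    intro i
    have e : gramDet f = fun z => Ef z * Gf z - Ff z * Ff z := by
      funext z; simp only [hEf, hFf, hGf, gramDet, sq]
    rw [e, partialD_sub (dE.fun_mul dG) (dF.fun_mul dF), partialD_mul dE dG, partialD_mul dF dF]
    ring
  -- the logarithmic derivative of `ρ = (EG - F²)^(-1/2)`
  have ρi : ∀ i, gramDet f y * (gramDet f y * ρ y * partialD i ρ y)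
      = -(partialD i (gramDet f) y / 2) := by
    intro i
    have h := partialD_mul dD (dρ.fun_mul dρ) i
    rw [partialD_congr hU hy hsq, partialD_const, partialD_mul dρ dρ] at h
    linear_combination (-(gramDet f y) / 2) * h + (-partialD i (gramDet f) y / 2) * hsq y hy
  set ℓ := -((Real.sqrt (g y).det)⁻¹ • ∑ i : Fin 2, partialD i
      (fun z => Real.sqrt (g z).det • ∑ j : Fin 2, (g z)⁻¹ i j • partialD j f z) y) with hℓ
  have key : gramDet f y • ℓ = -(secondDerivTrace f y
      + (partialD 0 Gf y - partialD 1 Ff y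
          + gramDet f y * ρ y * (partialD 0 ρ y * Gf y - partialD 1 ρ y * Ff y)) • partialD 0 f y
      + (partialD 1 Ef y - partialD 0 Ff y
          + gramDet f y * ρ y * (partialD 1 ρ y * Ef y - partialD 0 ρ y * Ff y))
        • partialD 1 f y) := by
    rw [hℓ, Fin.sum_univ_two, partialD_congr hU hy e0, partialD_congr hU hy e1, hdet y hy]
    change _ • (-(ρ y • _)) = _
    rw [partialD_smul dρ ((dG.fun_smul f0).fun_sub (dF.fun_smul f1)),
      partialD_smul dρ ((dE.fun_smul f1).fun_sub (dF.fun_smul f0)),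
      partialD_sub (dG.fun_smul f0) (dF.fun_smul f1),
      partialD_sub (dE.fun_smul f1) (dF.fun_smul f0),
      partialD_smul dG f0, partialD_smul dF f1, partialD_smul dE f1, partialD_smul dF f0, hc]
    have h : ∀ v : F, gramDet f y • (ρ y • (ρ y • v)) = v := by
      intro v
      rw [smul_smul, smul_smul, mul_assoc, hsq y hy, one_smul]
    have h0 := h (secondDerivTrace f y
      + (partialD 0 Gf y - partialD 1 Ff y) • partialD 0 f y
      + (partialD 1 Ef y - partialD 0 Ff y) • partialD 1 f y)
    unfold secondDerivTrace at h0 ⊢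
    change gramDet f y • ρ y • ρ y • ((Gf y • _ - (2 * Ff y) • _ + Ef y • _) + _ + _)
      = (Gf y • _ - (2 * Ff y) • _ + Ef y • _) + _ + _ at h0
    change _ = -((Gf y • _ - (2 * Ff y) • _ + Ef y • _) + _ + _)
    linear_combination (norm := module) (-1 : ℝ) • h0
  refine ⟨fun i => ?_, -(partialD 0 Gf y - partialD 1 Ff y
      + gramDet f y * ρ y * (partialD 0 ρ y * Gf y - partialD 1 ρ y * Ff y)),
    -(partialD 1 Ef y - partialD 0 Ff y
      + gramDet f y * ρ y * (partialD 1 ρ y * Ef y - partialD 0 ρ y * Ff y)),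
    by rw [key]; module⟩
  apply mul_left_cancel₀ (hD y hy).ne'
  rw [← real_inner_smul_left, key, mul_zero, inner_neg_left, inner_add_left, inner_add_left]
  unfold secondDerivTrace
  simp only [inner_add_left, inner_sub_left, real_inner_smul_left]
  have w0 := ρi 0
  have w1 := ρi 1
  rw [Di, Ei, Fi, Gi] at w0 w1
  rw [hc] at w1
  rw [Ei, Fi, Fi, Gi, hc]
  have hc' : ⟪partialD 1 f y, partialD 0 f y⟫ = Ff y := real_inner_comm _ _
  have hDy : gramDet f y = Ef y * Gf y - Ff y * Ff y := by
    simp only [hEf, hFf, hGf, gramDet, sq]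
  fin_cases i
  · simp only [Fin.zero_eta, hc']
    change -(Gf y * _ - 2 * Ff y * _ + Ef y * _ + _ * Ef y + _ * Ff y) = 0
    linear_combination -w0 + gramDet f y * ρ y * partialD 0 ρ y * hDy
  · change -(Gf y * _ - 2 * Ff y * _ + Ef y * _ + _ * Ff y + _ * Gf y) = 0
    simp only [Fin.mk_one]
    linear_combination -w1 + gramDet f y * ρ y * partialD 1 ρ y * hDy

end Divergence

/-! ### Isometric immersions of surfaces in charts -/

section SurfaceCharts

theorem IsLaplaceVector.congr {F : Type*} [NormedAddCommGroup F] [InnerProductSpace ℝ F]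
    {U : Set (EuclSpace 2)} (hU : IsOpen U) {f f' : EuclSpace 2 → F} (h : ∀ z ∈ U, f z = f' z)
    {y : EuclSpace 2} (hy : y ∈ U) {ℓ : F} (hℓ : IsLaplaceVector f y ℓ) :
    IsLaplaceVector f' y ℓ := by
  have h1 : ∀ z ∈ U, ∀ i, partialD i f z = partialD i f' z :=
    fun z hz i => partialD_congr hU hz h i
  have h2 : ∀ i j, partialD i (partialD j f) y = partialD i (partialD j f') y :=
    fun i j => partialD_congr hU hy (fun z hz => h1 z hz j) i
  obtain ⟨hn, α, β, ht⟩ := hℓ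
  refine ⟨fun i => by rw [← h1 y hy, hn], α, β, ?_⟩
  unfold gramDet secondDerivTrace at ht ⊢
  simpa only [h1 y hy, h2] using ht

variable {M : Type*} [TopologicalSpace M] [ChartedSpace (EuclSpace 2) M] [IsManifold (𝓡 2) ∞ M]

theorem fderiv_comp_extChartAt_symm {m : ℕ} {u : M → EuclSpace m} {p : M} {y : EuclSpace 2}
    (hy : y ∈ (extChartAt (𝓡 2) p).target)
    (hu : MDifferentiableAt (𝓡 2) 𝓘(ℝ, EuclSpace m) u ((extChartAt (𝓡 2) p).symm y))
    (v : EuclSpace 2) :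
    fderiv ℝ (fun z => u ((extChartAt (𝓡 2) p).symm z)) y v
      = differential u ((extChartAt (𝓡 2) p).symm y)
          (mfderiv 𝓘(ℝ, EuclSpace 2) (𝓡 2) (extChartAt (𝓡 2) p).symm y v) := by
  have hs : MDifferentiableAt 𝓘(ℝ, EuclSpace 2) (𝓡 2) (extChartAt (𝓡 2) p).symm y :=
    ((contMDiffOn_extChartAt_symm (n := ∞) p).contMDiffAt
      ((isOpen_extChartAt_target p).mem_nhds hy)).mdifferentiableAt (by simp)
  rw [← mfderiv_eq_fderiv]
  exact mfderiv_comp_apply (I' := 𝓡 2) y hu hs v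

theorem contDiffOn_comp_extChartAt_symm {m : ℕ} {u : M → EuclSpace m}
    (hu : ContMDiff (𝓡 2) 𝓘(ℝ, EuclSpace m) ∞ u) (p : M) :
    ContDiffOn ℝ ∞ (fun z => u ((extChartAt (𝓡 2) p).symm z)) (extChartAt (𝓡 2) p).target := by
  rw [← contMDiffOn_iff_contDiffOn]
  exact hu.comp_contMDiffOn (contMDiffOn_extChartAt_symm p)

theorem mfderiv_extChartAt_symm_ne_zero {p : M} {y : EuclSpace 2}
    (hy : y ∈ (extChartAt (𝓡 2) p).target) {v : EuclSpace 2} (hv : v ≠ 0) :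
    mfderiv 𝓘(ℝ, EuclSpace 2) (𝓡 2) (extChartAt (𝓡 2) p).symm y v ≠ 0 := by
  have : IsManifold (𝓡 2) 1 M := IsManifold.of_le (n := ∞) (by simp)
  have h := isInvertible_mfderivWithin_extChartAt_symm hy
  rw [ModelWithCorners.Boundaryless.range_eq_univ, mfderivWithin_univ] at h
  intro h0
  exact hv (h.injective (h0.trans (map_zero _).symm))

namespace IsIsometricImmersion

variable {g : SmoothMetric 2 M} {m : ℕ} {x : M → EuclSpace m}

theorem fderiv_normSq_pos (hx : IsIsometricImmersion g x) {p : M} {y : EuclSpace 2}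
    (hy : y ∈ (extChartAt (𝓡 2) p).target) {v : EuclSpace 2} (hv : v ≠ 0) :
    0 < ⟪fderiv ℝ (fun z => x ((extChartAt (𝓡 2) p).symm z)) y v,
      fderiv ℝ (fun z => x ((extChartAt (𝓡 2) p).symm z)) y v⟫ := by
  rw [fderiv_comp_extChartAt_symm hy (hx.smooth.mdifferentiable (by simp) _), hx.isometric]
  exact g.pos _ _ (mfderiv_extChartAt_symm_ne_zero hy hv)

theorem gramDet_pos (hx : IsIsometricImmersion g x) {p : M} {y : EuclSpace 2}
    (hy : y ∈ (extChartAt (𝓡 2) p).target) :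
    0 < gramDet (fun z => x ((extChartAt (𝓡 2) p).symm z)) y := by
  set f : EuclSpace 2 → EuclSpace m := fun z => x ((extChartAt (𝓡 2) p).symm z)
  have hE : 0 < ⟪partialD 0 f y, partialD 0 f y⟫ := hx.fderiv_normSq_pos hy (by simp)
  have h := hx.fderiv_normSq_pos hy
    (v := !₂[-⟪partialD 0 f y, partialD 1 f y⟫, ⟪partialD 0 f y, partialD 0 f y⟫]) (by
      intro h
      have := congrArg (fun w : EuclSpace 2 => w 1) h
      simp only [PiLp.zero_apply] at this
      exact hE.ne' this)
  rw [fderiv_eq_partialD] at h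
  change 0 < ⟪(-⟪partialD 0 f y, partialD 1 f y⟫) • partialD 0 f y
    + ⟪partialD 0 f y, partialD 0 f y⟫ • partialD 1 f y,
    (-⟪partialD 0 f y, partialD 1 f y⟫) • partialD 0 f y
    + ⟪partialD 0 f y, partialD 0 f y⟫ • partialD 1 f y⟫ at h
  simp only [inner_add_left, inner_add_right, real_inner_smul_left, real_inner_smul_right,
    real_inner_comm (partialD 0 f y) (partialD 1 f y)] at h
  unfold gramDet
  refine pos_of_mul_pos_right (a := ⟪partialD 0 f y, partialD 0 f y⟫) ?_ hE.le
  linarith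

theorem metricMatrix_apply (hx : IsIsometricImmersion g x) {p : M} {y : EuclSpace 2}
    (hy : y ∈ (extChartAt (𝓡 2) p).target) (i j : Fin 2) :
    metricMatrix g p y i j = ⟪partialD i (fun z => x ((extChartAt (𝓡 2) p).symm z)) y,
      partialD j (fun z => x ((extChartAt (𝓡 2) p).symm z)) y⟫ := by
  have hd := hx.smooth.mdifferentiable (by simp) ((extChartAt (𝓡 2) p).symm y)
  unfold partialD
  rw [fderiv_comp_extChartAt_symm hy hd, fderiv_comp_extChartAt_symm hy hd, hx.isometric]
  rfl

theorem isLaplaceVector_center (hx : IsIsometricImmersion g x) (p : M) :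
    IsLaplaceVector (fun z => x ((extChartAt (𝓡 2) p).symm z)) (extChartAt (𝓡 2) p p)
      (laplaceMap g x p) :=
  isLaplaceVector_of_divergence (isOpen_extChartAt_target p)
    (contDiffOn_comp_extChartAt_symm hx.smooth p) (fun _ hy => hx.gramDet_pos hy)
    (fun _ hz i j => hx.metricMatrix_apply hz i j) (mem_extChartAt_target p)

/-- The Laplace map, which is defined at each point by means of the preferred chart there, can be
computed in any chart. -/
theorem isLaplaceVector (hx : IsIsometricImmersion g x) {p : M} {y : EuclSpace 2}
    (hy : y ∈ (extChartAt (𝓡 2) p).target) :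
    IsLaplaceVector (fun z => x ((extChartAt (𝓡 2) p).symm z)) y
      (laplaceMap g x ((extChartAt (𝓡 2) p).symm y)) := by
  set q := (extChartAt (𝓡 2) p).symm y with hq
  have hqp : q ∈ (extChartAt (𝓡 2) p).source := (extChartAt (𝓡 2) p).map_target hy
  set W : Set (EuclSpace 2) := (extChartAt (𝓡 2) q).target ∩
    (extChartAt (𝓡 2) q).symm ⁻¹' (extChartAt (𝓡 2) p).source with hW
  have hWo : IsOpen W := (continuousOn_extChartAt_symm q).isOpen_inter_preimage
    (isOpen_extChartAt_target q) (isOpen_extChartAt_source p)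
  have hyW : extChartAt (𝓡 2) q q ∈ W :=
    ⟨mem_extChartAt_target q, by simpa [extChartAt_to_inv] using hqp⟩
  set τ : EuclSpace 2 → EuclSpace 2 :=
    fun z => extChartAt (𝓡 2) p ((extChartAt (𝓡 2) q).symm z) with hτ
  have hτs : ContDiffOn ℝ ∞ τ W := by
    rw [← contMDiffOn_iff_contDiffOn]
    refine (contMDiffOn_extChartAt (n := ∞) (x := p)).comp
      ((contMDiffOn_extChartAt_symm q).mono Set.inter_subset_left) ?_
    intro z hz
    simpa only [extChartAt_source] using hz.2
  have hτy : τ (extChartAt (𝓡 2) q q) = y := by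
    simp only [hτ, extChartAt_to_inv]
    exact (extChartAt (𝓡 2) p).right_inv hy
  have hcomp : ∀ z ∈ W, x ((extChartAt (𝓡 2) q).symm z)
      = x ((extChartAt (𝓡 2) p).symm (τ z)) := by
    intro z hz
    rw [hτ, (extChartAt (𝓡 2) p).left_inv hz.2]
  rw [← hτy]
  refine IsLaplaceVector.of_comp (f := fun z => x ((extChartAt (𝓡 2) p).symm z))
    (isOpen_extChartAt_target p) hWo
    (contDiffOn_comp_extChartAt_symm hx.smooth p) hτs
    (fun z hz => (extChartAt (𝓡 2) p).map_source hz.2) hyW ?_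
    ((hx.isLaplaceVector_center q).congr hWo hcomp hyW)
  have h1 : ∀ i, partialD i (fun z => x ((extChartAt (𝓡 2) q).symm z)) (extChartAt (𝓡 2) q q)
      = partialD i (fun z => x ((extChartAt (𝓡 2) p).symm (τ z))) (extChartAt (𝓡 2) q q) :=
    fun i => partialD_congr hWo hyW hcomp i
  have h := (hx.gramDet_pos (mem_extChartAt_target q)).ne'
  unfold gramDet at h ⊢
  simpa only [h1] using h

theorem contDiffOn_laplaceMap (hx : IsIsometricImmersion g x) (p : M) :
    ContDiffOn ℝ ∞ (fun z => laplaceMap g x ((extChartAt (𝓡 2) p).symm z))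
      (extChartAt (𝓡 2) p).target :=
  (contDiffOn_laplaceFormula (isOpen_extChartAt_target p)
    (contDiffOn_comp_extChartAt_symm hx.smooth p) (fun _ hy => (hx.gramDet_pos hy).ne')).congr
    fun _ hy => (hx.isLaplaceVector hy).eq_laplaceFormula (hx.gramDet_pos hy).ne'

theorem mdifferentiableAt_laplaceMap (hx : IsIsometricImmersion g x) (p : M) :
    MDifferentiableAt (𝓡 2) 𝓘(ℝ, EuclSpace m) (laplaceMap g x) p := by
  have h1 : ContMDiffAt 𝓘(ℝ, EuclSpace 2) 𝓘(ℝ, EuclSpace m) ∞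
      (fun z => laplaceMap g x ((extChartAt (𝓡 2) p).symm z)) (extChartAt (𝓡 2) p p) :=
    ((hx.contDiffOn_laplaceMap p).contDiffAt (extChartAt_target_mem_nhds p)).contMDiffAt
  have h2 := h1.comp p (contMDiffAt_extChartAt (I := 𝓡 2) (n := ∞) (x := p))
  refine (h2.congr_of_eventuallyEq ?_).mdifferentiableAt (by simp)
  filter_upwards [extChartAt_source_mem_nhds (I := 𝓡 2) p] with z hz
  simp only [Function.comp_apply]
  rw [(extChartAt (𝓡 2) p).left_inv hz]

end IsIsometricImmersion

end SurfaceCharts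

/-! ### Spheres -/

section Spheres

theorem IsLocallyConstant.of_partialD_eq_zero {M : Type*} [TopologicalSpace M]
    [ChartedSpace (EuclSpace 2) M] {F : Type*} [NormedAddCommGroup F] [InnerProductSpace ℝ F]
    {v : M → F}
    (hd : ∀ p : M, DifferentiableOn ℝ (fun z => v ((extChartAt (𝓡 2) p).symm z))
      (extChartAt (𝓡 2) p).target)
    (h : ∀ p : M, ∀ y ∈ (extChartAt (𝓡 2) p).target, ∀ i,
      partialD i (fun z => v ((extChartAt (𝓡 2) p).symm z)) y = 0) : IsLocallyConstant v := by
  rw [IsLocallyConstant.iff_eventually_eq]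
  intro p
  obtain ⟨ε, hε, hb⟩ := Metric.isOpen_iff.1 (isOpen_extChartAt_target (I := 𝓡 2) p) _
    (mem_extChartAt_target p)
  filter_upwards [extChartAt_source_mem_nhds (I := 𝓡 2) p,
    (continuousAt_extChartAt (I := 𝓡 2) p).preimage_mem_nhds (Metric.ball_mem_nhds _ hε)]
    with q hq hqb
  have := Metric.isOpen_ball.is_const_of_fderiv_eq_zero
    (convex_ball (extChartAt (𝓡 2) p p) ε).isPreconnected ((hd p).mono hb) (fun y hy => by
      ext1 w
      rw [fderiv_eq_partialD, h p y (hb hy), h p y (hb hy)]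
      simp) hqb (Metric.mem_ball_self hε)
  simpa only [(extChartAt (𝓡 2) p).left_inv hq, extChartAt_to_inv] using this

variable {M : Type*} [TopologicalSpace M] [ChartedSpace (EuclSpace 2) M] [IsManifold (𝓡 2) ∞ M]

/-- The cone over a patch of a sphere is open, hence so is the patch in the sphere. -/
theorem exists_isOpen_sphere_inter_subset_image {U : Set (EuclSpace 2)} (hU : IsOpen U)
    {f : EuclSpace 2 → EuclSpace 3} (hf : ContDiffOn ℝ ∞ f U) {a : EuclSpace 3} {r : ℝ} (hr : 0 < r)
    (hs : ∀ z ∈ U, ‖f z - a‖ = r) {y : EuclSpace 2} (hy : y ∈ U)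
    (himm : ∀ v, fderiv ℝ f y v = 0 → v = 0) :
    ∃ W : Set (EuclSpace 3), IsOpen W ∧ f y ∈ W ∧ Metric.sphere a r ∩ W ⊆ f '' U := by
  set Φ : ℝ × EuclSpace 2 → EuclSpace 3 := fun w => a + w.1 • (f w.2 - a) with hΦ
  have hfy : HasStrictFDerivAt f (fderiv ℝ f y) y :=
    (hf.contDiffAt (hU.mem_nhds hy)).hasStrictFDerivAt (by simp)
  have hd : HasStrictFDerivAt Φ ((1 : ℝ) • (fderiv ℝ f y).comp (ContinuousLinearMap.snd ℝ ℝ _)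
      + (ContinuousLinearMap.fst ℝ ℝ (EuclSpace 2)).smulRight (f y - a)) (1, y) := by
    have h2 : HasStrictFDerivAt (fun w : ℝ × EuclSpace 2 => f w.2 - a)
        ((fderiv ℝ f y).comp (ContinuousLinearMap.snd ℝ ℝ _)) (1, y) :=
      (HasStrictFDerivAt.comp (1, y) (g := f) hfy hasStrictFDerivAt_snd).sub_const a
    exact ((hasStrictFDerivAt_fst (𝕜 := ℝ) (p := ((1 : ℝ), y))).smul h2).const_add a
  set Φ' := (1 : ℝ) • (fderiv ℝ f y).comp (ContinuousLinearMap.snd ℝ ℝ _)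
      + (ContinuousLinearMap.fst ℝ ℝ (EuclSpace 2)).smulRight (f y - a) with hΦ'
  have hn : ∀ v, ⟪f y - a, fderiv ℝ f y v⟫ = 0 := by
    intro v
    have hd := hfy.hasFDerivAt.sub_const a
    have h1 := hd.inner ℝ hd
    have h2 : HasFDerivAt (fun z => ⟪f z - a, f z - a⟫) (0 : EuclSpace 2 →L[ℝ] ℝ) y := by
      refine (hasFDerivAt_const (r ^ 2) y).congr_of_eventuallyEq ?_
      filter_upwards [hU.mem_nhds hy] with z hz
      rw [real_inner_self_eq_norm_sq, hs z hz]
    have h3 := congrArg (fun T : EuclSpace 2 →L[ℝ] ℝ => T v) (h1.unique h2)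
    simp [fderivInnerCLM_apply] at h3
    rw [real_inner_comm (f y - a)] at h3
    linarith
  have hinj : Function.Injective Φ' := by
    rw [injective_iff_map_eq_zero]
    rintro ⟨t, v⟩ h
    have h' : fderiv ℝ f y v + t • (f y - a) = 0 := by simpa [hΦ'] using h
    have h1 := congrArg (fun w => ⟪f y - a, w⟫) h'
    simp only [inner_add_right, hn, real_inner_smul_right, real_inner_self_eq_norm_sq, hs y hy,
      inner_zero_right, zero_add] at h1
    have ht : t = 0 := (mul_eq_zero.1 h1).resolve_right (by positivity)
    rw [ht, zero_smul, add_zero] at h'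
    rw [ht, himm v h']
    rfl
  have hsurj : Φ'.range = ⊤ := by
    rw [LinearMap.range_eq_top]
    refine (LinearMap.injective_iff_surjective_of_finrank_eq_finrank (f := Φ'.toLinearMap) ?_).1 hinj
    simp [Module.finrank_prod]
  have hmap := hd.map_nhds_eq_of_surj hsurj
  have hS : {w : ℝ × EuclSpace 2 | 0 < w.1 ∧ w.2 ∈ U} ∈ nhds ((1 : ℝ), y) :=
    prod_mem_nhds (Ioi_mem_nhds one_pos) (hU.mem_nhds hy)
  have h := Filter.image_mem_map (m := Φ) hS
  rw [hmap] at h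
  obtain ⟨W, hWs, hWo, hyW⟩ := mem_nhds_iff.1 h
  refine ⟨W, hWo, by simpa [hΦ] using hyW, ?_⟩
  rintro b ⟨hbs, hbW⟩
  obtain ⟨⟨t, z⟩, ⟨ht, hz⟩, rfl⟩ := hWs hbW
  have ht1 : t = 1 := by
    rw [mem_sphere_iff_norm] at hbs
    simp only [hΦ, add_sub_cancel_left, norm_smul, hs z hz, Real.norm_eq_abs, abs_of_pos ht] at hbs
    exact mul_right_cancel₀ hr.ne' (by rw [hbs, one_mul])
  exact ⟨z, hz, by simp [hΦ, ht1]⟩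

namespace IsIsometricImmersion

variable {g : SmoothMetric 2 M} {x : M → EuclSpace 3}

theorem homotheticPatch (hx : IsIsometricImmersion g x) {c : ℝ} (hc : 0 < c)
    (h : ∀ (p : M) (v w : TangentSpace (𝓡 2) p),
      ⟪differential (laplaceMap g x) p v, differential (laplaceMap g x) p w⟫
        = c ^ 2 * g.inner p v w) (p : M) :
    HomotheticPatch (extChartAt (𝓡 2) p).target (fun z => x ((extChartAt (𝓡 2) p).symm z))
      (fun z => laplaceMap g x ((extChartAt (𝓡 2) p).symm z)) c where
  pos := hc
  isOpen := isOpen_extChartAt_target p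
  smooth := contDiffOn_comp_extChartAt_symm hx.smooth p
  smooth' := hx.contDiffOn_laplaceMap p
  gramDet_ne_zero _ hy := (hx.gramDet_pos hy).ne'
  laplace _ hy := hx.isLaplaceVector hy
  homothetic y hy i j := by
    have hd := hx.smooth.mdifferentiable (by simp) ((extChartAt (𝓡 2) p).symm y)
    have hL := hx.mdifferentiableAt_laplaceMap ((extChartAt (𝓡 2) p).symm y)
    unfold partialD
    rw [fderiv_comp_extChartAt_symm hy hd, fderiv_comp_extChartAt_symm hy hd,
      fderiv_comp_extChartAt_symm hy hL, fderiv_comp_extChartAt_symm hy hL, hx.isometric, h]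

theorem isOpenPortionOfSphere (hx : IsIsometricImmersion g x) {a : EuclSpace 3} {r : ℝ}
    (hr : 0 < r) (hs : ∀ p, ‖x p - a‖ = r) : IsOpenPortionOfSphere (Set.range x) := by
  have h : ∀ p : M, ∃ W : Set (EuclSpace 3), IsOpen W ∧ x p ∈ W ∧
      Metric.sphere a r ∩ W ⊆ Set.range x := by
    intro p
    obtain ⟨W, hWo, hpW, hW⟩ := exists_isOpen_sphere_inter_subset_image
      (isOpen_extChartAt_target (I := 𝓡 2) p)
      (contDiffOn_comp_extChartAt_symm hx.smooth p) hr (fun z _ => hs _) (mem_extChartAt_target p)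
      (fun v hv => by
        by_contra hv0
        have := hx.fderiv_normSq_pos (mem_extChartAt_target p) hv0
        rw [hv, inner_zero_left] at this
        exact this.false)
    refine ⟨W, hWo, by simpa only [extChartAt_to_inv] using hpW, hW.trans ?_⟩
    rintro _ ⟨z, -, rfl⟩
    exact ⟨_, rfl⟩
  choose W hWo hpW hW using h
  refine ⟨a, r, hr, ⋃ p, W p, isOpen_iUnion hWo, Set.Subset.antisymm ?_ ?_⟩
  · rintro _ ⟨p, rfl⟩
    exact ⟨by simpa using hs p, Set.mem_iUnion.2 ⟨p, hpW p⟩⟩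
  · rintro b ⟨hb, hbW⟩
    obtain ⟨p, hp⟩ := Set.mem_iUnion.1 hbW
    exact hW p ⟨hb, hp⟩

/-- On a sphere the Laplace vector is a constant multiple of the position vector with respect to the
centre. -/
theorem laplaceMap_eq_of_sphere (hx : IsIsometricImmersion g x) {a : EuclSpace 3} {r : ℝ}
    (hr : 0 < r) (hs : ∀ p, ‖x p - a‖ = r) (p : M) :
    laplaceMap g x p = (2 / r ^ 2) • (x p - a) := by
  set y := extChartAt (𝓡 2) p p
  set U := (extChartAt (𝓡 2) p).target
  have hU : IsOpen U := isOpen_extChartAt_target p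
  have hy : y ∈ U := mem_extChartAt_target p
  set f : EuclSpace 2 → EuclSpace 3 := fun z => x ((extChartAt (𝓡 2) p).symm z) with hfdef
  have hf : ContDiffOn ℝ ∞ f U := contDiffOn_comp_extChartAt_symm hx.smooth p
  have hfy : f y = x p := by simp only [hfdef, y, extChartAt_to_inv]
  have hD : 0 < gramDet f y := hx.gramDet_pos hy
  obtain ⟨hn, α, β, ht⟩ := hx.isLaplaceVector_center p
  have hna : ∀ i, ∀ z ∈ U, ⟪f z - a, partialD i f z⟫ = 0 := by
    intro i z hz
    have d := hf.diffAt hU hz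
    have h := partialD_inner (d.sub_const a) (d.sub_const a) i
    rw [partialD_congr (v := fun _ => r ^ 2) hU hz
      (fun w _ => by rw [real_inner_self_eq_norm_sq, hs]), partialD_const,
      partialD_sub d (differentiableAt_const a), partialD_const, sub_zero, real_inner_comm] at h
    rw [real_inner_comm]
    linarith
  have hnn : ∀ i j, ⟪f y - a, partialD j (partialD i f) y⟫
      = -⟪partialD j f y, partialD i f y⟫ := by
    intro i j
    have d := hf.diffAt hU hy
    have h := partialD_inner (d.sub_const a) ((hf.partialD hU i).diffAt hU hy) j
    rw [partialD_congr (v := fun _ => (0 : ℝ)) hU hy (fun w hw => hna i w hw), partialD_const,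
      partialD_sub d (differentiableAt_const a), partialD_const, sub_zero] at h
    linarith
  change ∀ i, ⟪laplaceMap g x p, partialD i f y⟫ = 0 at hn
  change gramDet f y • laplaceMap g x p + secondDerivTrace f y = α • partialD 0 f y
    + β • partialD 1 f y at ht
  set ℓ := laplaceMap g x p
  have h2 : ⟪f y - a, ℓ⟫ = 2 := by
    have h := congrArg (fun v => ⟪f y - a, v⟫) ht
    simp only [secondDerivTrace, inner_add_right, inner_sub_right, real_inner_smul_right, hna _ y hy,
      hnn] at h
    apply mul_left_cancel₀ hD.ne'
    unfold gramDet at h ⊢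
    linarith
  have hc := real_inner_comm (partialD 0 f y) (partialD 1 f y)
  have hf0 : partialD 0 f y ≠ 0 := by
    intro h
    simp [gramDet, h] at hD
  have hζ0 : ⟪partialD 0 f y, partialD 0 f y⟫ • partialD 1 f y
      - ⟪partialD 0 f y, partialD 1 f y⟫ • partialD 0 f y ≠ 0 := by
    intro h
    have h' := congrArg (fun v => ⟪partialD 1 f y, v⟫) h
    simp only [inner_sub_right, real_inner_smul_right, inner_zero_right] at h'
    unfold gramDet at hD
    rw [hc] at h'
    exact hD.ne' (by linear_combination h')
  have hnorm : ⟪f y - a, f y - a⟫ = r ^ 2 := by rw [real_inner_self_eq_norm_sq, hs]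
  have hna0 : f y - a ≠ 0 := by
    intro h
    rw [h, inner_zero_left] at hnorm
    exact (pow_pos hr 2).ne hnorm
  rw [← hfy, ← sub_eq_zero]
  apply eq_zero_of_orthogonal_triple hf0 hζ0 hna0
  · rw [inner_sub_left, real_inner_smul_left, real_inner_smul_left, hc]
    ring
  · exact hna 0 y hy
  · simp [inner_sub_right, real_inner_smul_right, hna _ y hy]
  · simp [inner_sub_left, real_inner_smul_left, hna _ y hy, hn]
  · simp [inner_sub_left, inner_sub_right, real_inner_smul_left, real_inner_smul_right,
      hna _ y hy, hn]
  · rw [inner_sub_left, real_inner_smul_left, hnorm, real_inner_comm, h2]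
    field_simp
    ring

end IsIsometricImmersion

end Spheres

end

theorem mainTheorem2 {M : Type*} [TopologicalSpace M] [T2Space M] [SecondCountableTopology M]
    [ConnectedSpace M] [ChartedSpace (EuclSpace 2) M] [IsManifold (𝓡 2) ∞ M]
    (g : SmoothMetric 2 M) (x : M → EuclSpace 3) (hx : IsIsometricImmersion g x) :
    HasHomotheticLaplaceTransformation g x ↔ IsOpenPortionOfSphere (Set.range x) := by
  constructor
  · rintro ⟨c, hc, h⟩
    have P := hx.homotheticPatch hc h
    have hlc : IsLocallyConstant (fun p => laplaceMap g x p - c • x p) := by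
      refine IsLocallyConstant.of_partialD_eq_zero (fun p => ?_) fun p y hy i => ?_
      · exact ((P p).smooth'.differentiableOn (by simp)).sub
          (((P p).smooth.differentiableOn (by simp)).fun_const_smul c)
      · have d1 := (P p).smooth'.diffAt (P p).isOpen hy
        have d2 := (P p).smooth.diffAt (P p).isOpen hy
        rw [partialD_sub d1 (d2.fun_const_smul c), partialD_const_smul c d2,
          (P p).partialD_eq hy, sub_self]
    obtain ⟨p₀⟩ := (inferInstance : Nonempty M)
    obtain ⟨b, hb⟩ : ∃ b, ∀ p, laplaceMap g x p - c • x p = b :=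
      ⟨_, fun p => hlc.apply_eq_of_isPreconnected isPreconnected_univ (Set.mem_univ p)
        (Set.mem_univ p₀)⟩
    have hL : ∀ p, laplaceMap g x p = c • (x p - -(c⁻¹ • b)) := by
      intro p
      rw [sub_neg_eq_add, smul_add, smul_inv_smul₀ hc.ne', ← hb p]
      abel
    set a := -(c⁻¹ • b)
    have hne : ∀ p, x p - a ≠ 0 := by
      intro p h0
      have := (P p).ne_zero (mem_extChartAt_target p)
      simp only [extChartAt_to_inv] at this
      exact this (by rw [hL, h0, smul_zero])
    -- `x - a` is normal to the surface, so its length is constant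
    have hlc' : IsLocallyConstant (fun p => inner ℝ (x p - a) (x p - a)) := by
      refine IsLocallyConstant.of_partialD_eq_zero (fun p => ?_) fun p y hy i => ?_
      · have h1 := ((P p).smooth.differentiableOn (by simp)).sub_const a
        exact h1.inner ℝ h1
      · have d := (P p).smooth.diffAt (P p).isOpen hy
        have hn := ((P p).laplace y hy).normal i
        rw [hL, real_inner_smul_left] at hn
        have hn' := (mul_eq_zero.1 hn).resolve_left hc.ne'
        rw [partialD_inner (d.sub_const a) (d.sub_const a),
          partialD_sub d (differentiableAt_const a), partialD_const, sub_zero, hn',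
          real_inner_comm, hn', add_zero]
    refine hx.isOpenPortionOfSphere (a := a) (r := ‖x p₀ - a‖) (norm_pos_iff.2 (hne p₀)) fun p => ?_
    have h2 := hlc'.apply_eq_of_isPreconnected isPreconnected_univ (Set.mem_univ p)
      (Set.mem_univ p₀)
    rw [real_inner_self_eq_norm_sq, real_inner_self_eq_norm_sq] at h2
    exact (pow_left_inj₀ (norm_nonneg _) (norm_nonneg _) two_ne_zero).1 h2
  · rintro ⟨a, r, hr, U, -, hU⟩
    have hs : ∀ p, ‖x p - a‖ = r := fun p =>
      mem_sphere_iff_norm.1 (hU ▸ Set.mem_range_self p : x p ∈ Metric.sphere a r ∩ U).1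
    refine ⟨2 / r ^ 2, by positivity, fun p v w => ?_⟩
    have e : laplaceMap g x = (fun q => (2 / r ^ 2) • (q - a)) ∘ x :=
      funext (hx.laplaceMap_eq_of_sphere hr hs)
    have hd : ∀ u : TangentSpace (𝓡 2) p,
        differential (laplaceMap g x) p u = (2 / r ^ 2) • differential x p u := by
      intro u
      have h1 : HasFDerivAt (fun q : EuclSpace 3 => (2 / r ^ 2) • (q - a))
          ((2 / r ^ 2) • ContinuousLinearMap.id ℝ (EuclSpace 3)) (x p) :=
        ((hasFDerivAt_id (x p)).sub_const a).fun_const_smul _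
      have h2 := h1.hasMFDerivAt.comp p
        (hx.smooth.mdifferentiable (by simp) p).hasMFDerivAt
      unfold differential
      rw [e, h2.mfderiv]
      rfl
    rw [hd, hd, real_inner_smul_left, real_inner_smul_right, hx.isometric]
    ring
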